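/- A *network mixed-integer polynomial optimization problem* (NPO) over a finite simple undirected graph $G$ in variables $x_1,\dots,x_n$ ($n\ge 1$) is a problem $$\min\ c^Tx\quad\text{s.t.}\quad f_u^k(x):=\sum_{v:\{u,v\}\in E(G)}p^k_{u,v}(X_u\cup X_v)\ \ge\ 0\quad(u\in V(G),\ 1\le k\le K_u),\qquad x_j\in\{0,1\}\ (j\in B),\quad x_j\in[0,1]\ (j\notin B),$$ where $B\subseteq\{1,\dots,n\}$, each vertex $v$ has a set $X_v$ of associated variables, each $p^k_{u,v}$ is a real polynomial in the variables of $X_u\cup X_v$, and for each $j$ the set $\{v: x_j\in X_v\}$ induces a connected (possibly empty) subgraph of $G$. For a polynomial $f$ let $\|f\|_1$ be the sum of the absolute values of its coefficients. A point $x$ satisfying the bound and integrality conditions is *scaled-$\epsilon$ feasible* if $f_u^k(x)\ge-\epsilon\|f_u^k\|_1$ for all $u,k$. **Theorem.** There is an absolute constant $C$ such that the following holds. Consider the constraints of an NPO in $n$ variables over a graph $G$ of tree-width at most $\omega$ and maximum degree at most $D$, where $D\ge1$; suppose every $p^k_{u,v}$ has degree at most $\pi$, where $\pi\ge1$, and $|X_v|+K_v\le\Delta$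 for every vertex $v$. Let $0<\epsilon<1$. Then there are a system of linear inequalities $Ay\ge b$ and a matrix $M$ (both independent of the objective $c$) such that 1. the number of variables plus the number of inequalities of the system is at most $$C\,\Bigl(\frac{2D\pi}{\epsilon}\Bigr)^{C\Delta\omega}\,n\,\log\frac{2\pi}{\epsilon};$$ 2. all entries of $A$ and $b$ lie in $\{-1,0,1\}$, and the entries of $M$ are fractions in $[0,1]$ with a common denominator that is a positive integer at most $C D\pi/\epsilon$; 3. for every $c\in\mathbb R^n$, the linear program $\min\{c^TMy : Ay\ge b\}$ solves the NPO with objective $c^Tx$ within scaled tolerance $\epsilon$, that is: - if the linear program is feasible, it has an optimal solution; - for each feasible $x$ of the NPO there is a feasible $y$ of the linear program with $c^TMy\le c^Tx+\epsilon\|c\|_1$; - for each optimal solution $y^*$ of the linear program there is a scaled-$\epsilon$ feasible $x^*$ with $c^Tx^*=c^TMy^*$; if $y^*$ is an extreme point of $\{y : Ay\ge b\}$, one can take $x^*=My^*$. -/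

import Mathlib

/-- A tree-decomposition of a graph `G`: a finite tree `tree` and a bag `bag t` of vertices of `G`
for each node `t`, such that the nodes whose bags contain a given vertex form a (nonempty) subtree,
and both ends of each edge lie in a common bag. -/
structure TreeDecomposition {V : Type*} (G : SimpleGraph V) where
  nodes : ℕ
  tree : SimpleGraph (Fin nodes)
  isTree : tree.IsTree
  bag : Fin nodes → Finset V
  subtree : ∀ v : V, (tree.induce {t | v ∈ bag t}).Connected
  edge : ∀ u v : V, G.Adj u v → ∃ t, u ∈ bag t ∧ v ∈ bag t

/-- `G` has tree-width at most `k`: some tree-decomposition has width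
`max_t |bag t| - 1` at most `k`. -/
def TreeWidthLE {V : Type*} (G : SimpleGraph V) (k : ℕ) : Prop :=
  ∃ T : TreeDecomposition G, ∀ t, (T.bag t).card ≤ k + 1

/-- The 1-norm of the coefficient vector of a polynomial. -/
noncomputable def polyL1Norm {n : ℕ} (f : MvPolynomial (Fin n) ℝ) : ℝ :=
  ∑ m ∈ f.support, |f.coeff m|

/-- The data of a network mixed-integer polynomial optimization problem in the variables
`x_0, …, x_{n-1}`, apart from its linear objective: the network `graph`, the set of binary
variables (the others range over `[0,1]`), the set `X v` of variables associated with the vertex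
`v`, and for each vertex `u` a number `K u` of constraints
`∑_{v adjacent to u} p_{u,v}^k (X_u ∪ X_v) ≥ 0`, `k < K u`. Only the polynomials `poly u v k`
with `u` adjacent to `v` matter. -/
structure NPO (V : Type*) (n : ℕ) where
  graph : SimpleGraph V
  binary : Finset (Fin n)
  X : V → Finset (Fin n)
  K : V → ℕ
  poly : (u v : V) → Fin (K u) → MvPolynomial (Fin n) ℝ
  /-- `p_{u,v}^k` is a polynomial in the variables of `X_u ∪ X_v` only. -/
  poly_vars : ∀ u v k, graph.Adj u v → (poly u v k).vars ⊆ X u ∪ X v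
  /-- The vertices with which a given variable is associated induce a connected subgraph. -/
  X_connected : ∀ j : Fin n, (graph.induce {v | j ∈ X v}).Preconnected

namespace NPO

variable {V : Type*} [Fintype V] {n : ℕ}

open scoped Classical in
/-- The left-hand side `∑_{{u,v} ∈ δ(u)} p_{u,v}^k` of the `k`-th constraint of the vertex `u`,
as a polynomial. -/
noncomputable def lhs (P : NPO V n) (u : V) (k : Fin (P.K u)) : MvPolynomial (Fin n) ℝ :=
  ∑ v with P.graph.Adj u v, P.poly u v k

/-- `x ∈ {0,1}` in the binary coordinates and `x ∈ [0,1]` in the others. -/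
def InBox (P : NPO V n) (x : Fin n → ℝ) : Prop :=
  ∀ j, (0 ≤ x j ∧ x j ≤ 1) ∧ (j ∈ P.binary → x j = 0 ∨ x j = 1)

def Feasible (P : NPO V n) (x : Fin n → ℝ) : Prop :=
  P.InBox x ∧ ∀ u k, 0 ≤ MvPolynomial.eval x (P.lhs u k)

/-- Scaled-`ε` feasibility: the bounds and integrality hold exactly, and a constraint `f ≥ 0` is
violated by at most `ε ‖f‖₁`. -/
def ScaledFeasible (P : NPO V n) (ε : ℝ) (x : Fin n → ℝ) : Prop :=
  P.InBox x ∧ ∀ u k, -(ε * polyL1Norm (P.lhs u k)) ≤ MvPolynomial.eval x (P.lhs u k)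

end NPO

/-- A linear program `min {obj ⬝ᵥ y : A *ᵥ y ≥ b}` with `s` real variables and `r` constraints. -/
structure LinProg (s r : ℕ) where
  A : Matrix (Fin r) (Fin s) ℝ
  b : Fin r → ℝ
  obj : Fin s → ℝ

namespace LinProg

variable {s r : ℕ}

def feasibleSet (L : LinProg s r) : Set (Fin s → ℝ) :=
  {y | ∀ i, L.b i ≤ (L.A.mulVec y) i}

def IsOptimal (L : LinProg s r) (y : Fin s → ℝ) : Prop :=
  y ∈ L.feasibleSet ∧ ∀ z ∈ L.feasibleSet, L.obj ⬝ᵥ y ≤ L.obj ⬝ᵥ z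

end LinProg

/-- The linear program `L`, with the linear map `M` from its variables to those of `P`, solves
`min {c ⬝ᵥ x : x feasible for P}` within scaled tolerance `ε`:
the objective of `L` is `y ↦ c ⬝ᵥ (M y)`; if `L` is feasible then it has an optimal solution; each
feasible `x` of `P` gives a feasible `y` of `L` whose objective value is at most
`c ⬝ᵥ x + ε ‖c‖₁`; and from each optimal solution `y` of `L` one obtains a scaled-`ε` feasible `x`
with `c ⬝ᵥ x` equal to the optimal value of `L`, which can be taken to be `M y` whenever `y` is an
extreme point of the feasible region. -/
structure SolvesWithin {V : Type*} [Fintype V] {n s r : ℕ} (L : LinProg s r)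
    (M : Matrix (Fin n) (Fin s) ℝ) (P : NPO V n) (c : Fin n → ℝ) (ε : ℝ) : Prop where
  objective : ∀ y, L.obj ⬝ᵥ y = c ⬝ᵥ M.mulVec y
  attained : L.feasibleSet.Nonempty → ∃ y, L.IsOptimal y
  relax : ∀ x, P.Feasible x →
    ∃ y ∈ L.feasibleSet, L.obj ⬝ᵥ y ≤ c ⬝ᵥ x + ε * ∑ j, |c j|
  recover : ∀ y, L.IsOptimal y → ∃ x, P.ScaledFeasible ε x ∧ c ⬝ᵥ x = L.obj ⬝ᵥ y ∧
    (y ∈ Set.extremePoints ℝ L.feasibleSet → x = M.mulVec y)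

/-! Three reductions are combined: rounding, dynamic programming on a tree, and integrality of the
linear program of locally consistent states on a forest.

Rounding. With H about 2D/ε and N = Hπ, points are rounded down to the grid of mesh 1/N, and a
constraint f ≥ 0 is replaced by the condition that integers ⌈H·(part of f for v)/‖f‖₁⌉, summed over
the neighbours v, give at least -1. Rounding x costs Hf/‖f‖₁ at most 1, so feasible points survive
(`NPO.exists_mem_points`); the ceilings add at most D, so every surviving point is scaled-ε feasible
(`NPO.scaledFeasible_gridPoint`). All coordinates and all partial sums of a constraint now take O(N)
values.

Gluing. Each pair of adjacent vertices is located at a tree node carrying all its variables. A node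
needs to share with its parent only the values of its variables and, for each constraint whose
subtree contains both nodes, the part of the sum located below. If surviving points chosen at the
nodes agree on these labels along every edge, they glue to one surviving point
(`IntegerModel.exists_point`). A state of a node consists of its own label and those of its
children, so the tree is first made binary, and then contracted to at most 2n + 1 nodes, which makes
the size linear in n.

Linear program. Its variables are weights on the states of each node, with total 1 and equal
marginals on the labels shared along each edge. As the graph of nodes is a forest, the support of
any feasible y contains a consistent choice of states, a small multiple of which can be split off
(`StateForest.exists_convex_combination`). If y is optimal, that choice is optimal too; if y is
extreme, y equals it. The polynomials only determine which states occur, so the coefficients are 0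
or ±1. -/

/-! ### The linear program of a forest of states -/

/-- A family of finite state sets `states i ⊆ Z`, where `i` ranges over a forest given by a parent
function, and for each `i` an interface map `port i` through which the states of `i` and of its
parent are compared. -/
structure StateForest (ι Z Q : Type*) where
  par : ι → ι
  dep : ι → ℕ
  dep_par : ∀ i, par i = i ∨ dep (par i) < dep i
  states : ι → Finset Z
  port : ι → Z → Q

namespace StateForest

variable {ι Z Q : Type*} (F : StateForest ι Z Q)

/-- A choice of states that agree along the edges of the forest. -/
def Consistent (α : ι → Z) : Prop :=
  ∀ i, α i ∈ F.states i ∧ F.port i (α i) = F.port i (α (F.par i))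

/-- States of all nodes, from states of the roots and a rule to pass from a node to a child. -/
noncomputable def descend (init : ι → Z) (next : ι → Z → Z) (i : ι) : Z :=
  open scoped Classical in
  if _h : F.par i = i then init i else next i (descend init next (F.par i))
termination_by F.dep i
decreasing_by exact (F.dep_par i).resolve_left _h

/-- A node is compared only with its parent, so states can be chosen from the roots downwards
without backtracking. The predicate `S` is the invariant maintained during the descent. -/
lemma exists_consistent (S : ι → Z → Prop) (hS : ∀ i z, S i z → z ∈ F.states i)
    (hinit : ∀ i, ∃ z, S i z)
    (hnext : ∀ i z, S (F.par i) z → ∃ z', S i z' ∧ F.port i z' = F.port i z) :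
    ∃ α, F.Consistent α ∧ ∀ i, S i (α i) := by
  classical
  choose init hinit using hinit
  have hnext' : ∀ i z, ∃ z', S (F.par i) z → S i z' ∧ F.port i z' = F.port i z := by
    intro i z
    by_cases h : S (F.par i) z
    · obtain ⟨z', hz'⟩ := hnext i z h
      exact ⟨z', fun _ => hz'⟩
    · exact ⟨z, fun h' => absurd h' h⟩
  choose next hnext' using hnext'
  have key : ∀ k i, F.dep i < k → S i (F.descend init next i) := by
    intro k
    induction k with
    | zero => intro i hi; omega
    | succ k ih =>
      intro i hi
      rw [descend]
      split_ifs with h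
      · exact hinit i
      · have := (F.dep_par i).resolve_left h
        exact (hnext' i _ (ih (F.par i) (by omega))).1
  have key' : ∀ i, S i (F.descend init next i) := fun i => key _ i (Nat.lt_succ_self _)
  refine ⟨F.descend init next, fun i => ⟨hS _ _ (key' i), ?_⟩, key'⟩
  by_cases h : F.par i = i
  · rw [h]
  · rw [descend, dif_neg h]
    exact (hnext' i _ (key' _)).2

/-- The index type of the variables of the linear program: pairs of a node and one of its states. -/
abbrev Var := (i : ι) × F.states i

/-- The index type of the inequalities: nonnegativity of the variables, the two inequalities of
each normalisation and the two inequalities of each port condition. -/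
abbrev Row := F.Var ⊕ (ι × Bool) ⊕ (((i : ι) × (F.states i ⊕ F.states (F.par i))) × Bool)

/-- The value of the port of `i` at which a port condition is imposed. -/
def portValue (p : (i : ι) × (F.states i ⊕ F.states (F.par i))) : Q :=
  match p.2 with
  | .inl z => F.port p.1 z
  | .inr z => F.port p.1 z

/-- The sign of an inequality that is one half of an equation. -/
def boolSign (s : Bool) : ℝ := if s then 1 else -1

open scoped Classical in
/-- The coefficients of the linear program. -/
noncomputable def coeff : F.Row → F.Var → ℝ
  | .inl p, k => if k = p then 1 else 0
  | .inr (.inl (i, s)), k => boolSign s * if k.1 = i then 1 else 0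
  | .inr (.inr (p, s)), k => boolSign s *
      ((if k.1 = p.1 ∧ F.port p.1 k.2 = F.portValue p then 1 else 0) -
        if k.1 = F.par p.1 ∧ F.port p.1 k.2 = F.portValue p then 1 else 0)

/-- The right-hand sides of the linear program. -/
def rhs : F.Row → ℝ
  | .inl _ => 0
  | .inr (.inl (_, s)) => boolSign s
  | .inr (.inr _) => 0

/-- A port row is a difference of two 0/1 indicators; at a root, which is its own parent, they
cancel. -/
lemma coeff_mem (p : F.Row) (k : F.Var) : F.coeff p k ∈ ({-1, 0, 1} : Set ℝ) := by
  rcases p with p | ⟨i, s⟩ | ⟨p, s⟩ <;> simp only [coeff, boolSign] <;> split_ifs <;> norm_num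

lemma rhs_mem (p : F.Row) : F.rhs p ∈ ({-1, 0, 1} : Set ℝ) := by
  rcases p with p | ⟨i, s⟩ | ⟨p, s⟩ <;> simp only [rhs, boolSign] <;> (try split_ifs) <;> norm_num

variable [Fintype ι]

open scoped Classical in
/-- The sum of the entries of `y` at the states of `i` whose `port i'` has value `q`. -/
noncomputable def marginal (y : F.Var → ℝ) (i i' : ι) (q : Q) : ℝ :=
  ∑ z : F.states i, if F.port i' z = q then y ⟨i, z⟩ else 0

/-- The feasible set of the linear program. -/
structure LPFeasible (y : F.Var → ℝ) : Prop where
  nonneg : ∀ k, 0 ≤ y k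
  sum_eq : ∀ i, ∑ z : F.states i, y ⟨i, z⟩ = 1
  port_eq : ∀ i, ∀ z ∈ (F.states i : Set Z) ∪ F.states (F.par i),
    F.marginal y i i (F.port i z) = F.marginal y (F.par i) i (F.port i z)

lemma boolSign_forall (a b : ℝ) : (∀ s, boolSign s * b ≤ boolSign s * a) ↔ a = b := by
  simp only [boolSign, Bool.forall_bool]
  constructor
  · rintro ⟨h1, h2⟩
    norm_num at h1 h2
    linarith
  · rintro rfl
    simp

open scoped Classical in
lemma sum_node (y : F.Var → ℝ) (i : ι) (g : Z → Prop) :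
    ∑ k : F.Var, (if k.1 = i ∧ g k.2 then 1 else 0) * y k =
      ∑ z : F.states i, if g z then y ⟨i, z⟩ else 0 := by
  rw [Fintype.sum_sigma, Finset.sum_eq_single i]
  · refine Finset.sum_congr rfl fun z _ => ?_
    simp
  · intro j _ hj
    refine Finset.sum_eq_zero fun z _ => ?_
    simp [hj]
  · simp

lemma lpFeasible_iff (y : F.Var → ℝ) :
    (∀ p, F.rhs p ≤ ∑ k, F.coeff p k * y k) ↔ F.LPFeasible y := by
  classical
  have h1 : ∀ p : F.Var, ∑ k, F.coeff (.inl p) k * y k = y p := by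
    intro p
    simp [coeff]
  have h2 : ∀ i s, ∑ k, F.coeff (.inr (.inl (i, s))) k * y k =
      boolSign s * ∑ z : F.states i, y ⟨i, z⟩ := by
    intro i s
    have := F.sum_node y i (fun _ => True)
    simp only [and_true, if_true] at this
    simp only [coeff, mul_assoc, ← Finset.mul_sum, this]
  have h3 : ∀ p s, ∑ k, F.coeff (.inr (.inr (p, s))) k * y k =
      boolSign s * (F.marginal y p.1 p.1 (F.portValue p) -
        F.marginal y (F.par p.1) p.1 (F.portValue p)) := by
    intro p s
    have e1 := F.sum_node y p.1 (fun z => F.port p.1 z = F.portValue p)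
    have e2 := F.sum_node y (F.par p.1) (fun z => F.port p.1 z = F.portValue p)
    simp only [coeff, mul_assoc, ← Finset.mul_sum, sub_mul, Finset.sum_sub_distrib, e1, e2,
      marginal]
  constructor
  · intro h
    refine ⟨fun k => ?_, fun i => ?_, fun i z hz => ?_⟩
    · have := h (.inl k)
      rwa [h1] at this
    · refine (boolSign_forall _ _).1 fun s => ?_
      have := h (.inr (.inl (i, s)))
      rw [h2] at this
      simpa [rhs] using this
    · rw [← sub_eq_zero]
      refine (boolSign_forall _ _).1 fun s => ?_
      rcases hz with hz | hz
      · have := h (.inr (.inr (⟨i, .inl ⟨z, hz⟩⟩, s)))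
        rw [h3] at this
        simpa [rhs, portValue] using this
      · have := h (.inr (.inr (⟨i, .inr ⟨z, hz⟩⟩, s)))
        rw [h3] at this
        simpa [rhs, portValue] using this
  · rintro ⟨f1, f2, f3⟩ (p | ⟨i, s⟩ | ⟨⟨i, z⟩, s⟩)
    · rw [h1]; exact f1 p
    · rw [h2, f2]; simp [rhs]
    · rw [h3, sub_eq_zero.2]
      · simp [rhs]
      · rcases z with z | z
        · exact f3 i z (Or.inl z.2)
        · exact f3 i z (Or.inr z.2)

open scoped Classical in
/-- The `0/1`-vector of a choice of states. -/
noncomputable def indicator (α : ι → Z) : F.Var → ℝ := fun k => if α k.1 = k.2 then 1 else 0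

omit [Fintype ι] in
lemma sum_indicator {α : ι → Z} (hα : F.Consistent α) (i : ι) (g : Z → ℝ) :
    ∑ z : F.states i, F.indicator α ⟨i, z⟩ * g z = g (α i) := by
  classical
  rw [Finset.sum_eq_single ⟨α i, (hα i).1⟩]
  · simp [indicator]
  · rintro ⟨z, hz⟩ _ hne
    have : α i ≠ z := fun h => hne (by simp [h])
    simp [indicator, this]
  · simp

omit [Fintype ι] in
lemma lpFeasible_indicator {α : ι → Z} (hα : F.Consistent α) : F.LPFeasible (F.indicator α) := by
  classical
  have h : ∀ i i' q, F.marginal (F.indicator α) i i' q = if F.port i' (α i) = q then 1 else 0 := by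
    intro i i' q
    rw [← F.sum_indicator hα i (fun z => if F.port i' z = q then 1 else 0)]
    simp [marginal]
  refine ⟨fun k => ?_, fun i => ?_, fun i z _ => ?_⟩
  · unfold indicator; split_ifs <;> norm_num
  · simpa using F.sum_indicator hα i (fun _ => 1)
  · rw [h, h, (hα i).2]

-- The support of `y` admits the descent: total weight 1 gives a root a state of positive weight,
-- and if the parent's state has positive weight then so does its marginal, hence the equal marginal
-- of the child, hence some child state with the same port.
omit [Fintype ι] in
lemma exists_consistent_pos {y : F.Var → ℝ} (hy : F.LPFeasible y) :
    ∃ α, F.Consistent α ∧ ∀ k, α k.1 = k.2 → 0 < y k := by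
  classical
  obtain ⟨α, hα, hpos⟩ := F.exists_consistent (fun i z => ∃ h : z ∈ F.states i, 0 < y ⟨i, z, h⟩)
    (fun i z h => h.1)
    (by
      intro i
      by_contra! hcon
      have := hy.sum_eq i
      rw [Finset.sum_nonpos (fun z _ => hcon z.1 z.2) |>.antisymm
        (Finset.sum_nonneg fun z _ => hy.nonneg _)] at this
      norm_num at this)
    (by
      rintro i z ⟨hz, hpos⟩
      have h1 := hy.port_eq i z (Or.inr hz)
      have h2 : 0 < F.marginal y (F.par i) i (F.port i z) := by
        refine Finset.sum_pos' (fun w _ => ?_) ⟨⟨z, hz⟩, Finset.mem_univ _, ?_⟩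
        · split_ifs
          · exact hy.nonneg _
          · exact le_rfl
        · simpa using hpos
      rw [← h1] at h2
      by_contra! hcon
      refine absurd h2 (not_lt.2 (Finset.sum_nonpos fun w _ => ?_))
      split_ifs with hw
      · by_contra! hw'
        exact hcon w ⟨w.2, hw'⟩ hw
      · exact le_rfl)
  refine ⟨α, hα, ?_⟩
  rintro ⟨i, z⟩ h
  obtain ⟨h1, h2⟩ := hpos i
  have : (⟨α i, h1⟩ : F.states i) = z := Subtype.ext h
  rwa [← this]

/-- A feasible point is a proper convex combination of a feasible point and a `0/1`-point. -/
lemma exists_convex_combination {y : F.Var → ℝ} (hy : F.LPFeasible y) :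
    ∃ α, F.Consistent α ∧ ∃ y', F.LPFeasible y' ∧ ∃ δ : ℝ, 0 < δ ∧ δ < 1 ∧
      y = (1 - δ) • y' + δ • F.indicator α := by
  classical
  obtain ⟨α, hα, hpos⟩ := F.exists_consistent_pos hy
  have hz := F.lpFeasible_indicator hα
  -- The least weight of a chosen state; any positive number serves when there are no nodes.
  obtain ⟨δ, hδ0, hδ⟩ : ∃ δ : ℝ, 0 < δ ∧ ∀ k, α k.1 = k.2 → δ ≤ y k := by
    by_cases hne : ((Finset.univ : Finset F.Var).filter fun k => α k.1 = k.2).Nonempty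
    · obtain ⟨k, hk, hmin⟩ := Finset.exists_min_image _ y hne
      exact ⟨y k, hpos k (Finset.mem_filter.1 hk).2, fun l hl => hmin l (by simpa using hl)⟩
    · exact ⟨1, one_pos, fun k hk => absurd ⟨k, by simpa using hk⟩ hne⟩
  obtain ⟨d, hd0, hd1, hd⟩ : ∃ d : ℝ, 0 < d ∧ d < 1 ∧ ∀ k, d * F.indicator α k ≤ y k := by
    -- The cap 1/2 keeps the remaining mass 1 - d positive, so that the remainder can be rescaled to
    -- a feasible point.
    refine ⟨min δ (1 / 2), by positivity, (min_le_right _ _).trans_lt (by norm_num), fun k => ?_⟩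
    unfold indicator
    split_ifs with h
    · simpa using Or.inl (hδ k h)
    · simpa using hy.nonneg k
  have hd2 : (1 - d) ≠ 0 := by linarith
  refine ⟨α, hα, fun k => (1 - d)⁻¹ * (y k - d * F.indicator α k), ?_, d, hd0, hd1, ?_⟩
  · have hm : ∀ i i' q, F.marginal (fun k => (1 - d)⁻¹ * (y k - d * F.indicator α k)) i i' q =
        (1 - d)⁻¹ * (F.marginal y i i' q - d * F.marginal (F.indicator α) i i' q) := by
      intro i i' q
      simp only [marginal, Finset.mul_sum, ← Finset.sum_sub_distrib]
      refine Finset.sum_congr rfl fun z _ => ?_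
      split_ifs <;> ring
    refine ⟨fun k => mul_nonneg (inv_nonneg.2 (by linarith)) (by linarith [hd k]), fun i => ?_,
      fun i z h => ?_⟩
    · rw [← Finset.mul_sum, Finset.sum_sub_distrib, ← Finset.mul_sum, hy.sum_eq, hz.sum_eq]
      field_simp
    · rw [hm, hm, hy.port_eq i z h, hz.port_eq i z h]
  · ext k
    simp only [Pi.add_apply, Pi.smul_apply, smul_eq_mul]
    field_simp
    ring

omit [Fintype ι] in
lemma LPFeasible.le_one {y : F.Var → ℝ} (hy : F.LPFeasible y) (k : F.Var) : y k ≤ 1 := by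
  obtain ⟨i, z⟩ := k
  rw [← hy.sum_eq i]
  exact Finset.single_le_sum (f := fun z : F.states i => y ⟨i, z⟩) (fun w _ => hy.nonneg _)
    (Finset.mem_univ z)

/-- With m nodes there are at most mq variables, mq sign rows, 2m normalisation rows and 4mq port
rows, hence the factor 8. -/
lemma card_var_add_card_row {q : ℕ} (hq : 1 ≤ q) (hcard : ∀ i, (F.states i).card ≤ q) :
    Fintype.card F.Var + Fintype.card F.Row ≤ 8 * Fintype.card ι * q := by
  have h1 : Fintype.card F.Var ≤ Fintype.card ι * q := by
    rw [Fintype.card_sigma]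
    refine (Finset.sum_le_card_nsmul _ _ q fun i _ => ?_).trans (by simp)
    simpa using hcard i
  have h2 : Fintype.card ((i : ι) × (F.states i ⊕ F.states (F.par i))) ≤
      Fintype.card ι * (2 * q) := by
    rw [Fintype.card_sigma]
    refine (Finset.sum_le_card_nsmul _ _ (2 * q) fun i _ => ?_).trans (by simp)
    have := hcard i
    have := hcard (F.par i)
    simp only [Fintype.card_sum, Fintype.card_coe]
    omega
  have h3 : Fintype.card ι ≤ Fintype.card ι * q := Nat.le_mul_of_pos_right _ hq
  simp only [Fintype.card_sum, Fintype.card_prod, Fintype.card_bool] at h1 h2 ⊢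
  nlinarith

end StateForest

/-- A consistent choice of states of a forest, read off at certain nodes, describes points of a
network problem; the linear program of the forest then solves the problem. -/
theorem StateForest.exists_linProg {V : Type*} [Fintype V] {n : ℕ} (P : NPO V n) (ε : ℝ)
    {ι Z Q : Type*} [Fintype ι] (F : StateForest ι Z Q) {q N : ℕ} (hq : 1 ≤ q)
    (hcard : ∀ i, (F.states i).card ≤ q) (node : Fin n → ι) (val : Fin n → Z → ℕ)
    (hval : ∀ j, ∀ z ∈ F.states (node j), val j z ≤ N)
    (sound : ∀ α, F.Consistent α → P.ScaledFeasible ε fun j => val j (α (node j)) / N)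
    (complete : ∀ (c x : Fin n → ℝ), P.Feasible x → ∃ α, F.Consistent α ∧
      (c ⬝ᵥ fun j => (val j (α (node j)) / N : ℝ)) ≤ c ⬝ᵥ x + ε * ∑ j, |c j|) :
    ∃ (s r : ℕ) (A : Matrix (Fin r) (Fin s) ℝ) (b : Fin r → ℝ) (M : Matrix (Fin n) (Fin s) ℝ),
      s + r ≤ 8 * Fintype.card ι * q ∧
      (∀ i k, A i k ∈ ({-1, 0, 1} : Set ℝ)) ∧
      (∀ i, b i ∈ ({-1, 0, 1} : Set ℝ)) ∧
      (∀ j k, ∃ a : ℕ, a ≤ N ∧ M j k = a / N) ∧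
      ∀ c : Fin n → ℝ, SolvesWithin ⟨A, b, Matrix.vecMul c M⟩ M P c ε := by
  classical
  let ev := Fintype.equivFin F.Var
  let er := Fintype.equivFin F.Row
  let M : Matrix (Fin n) (Fin (Fintype.card F.Var)) ℝ := fun j k =>
    if (ev.symm k).1 = node j then (val j (ev.symm k).2 / N : ℝ) else 0
  let A : Matrix (Fin (Fintype.card F.Row)) (Fin (Fintype.card F.Var)) ℝ :=
    fun i k => F.coeff (er.symm i) (ev.symm k)
  let b : Fin (Fintype.card F.Row) → ℝ := fun i => F.rhs (er.symm i)
  have hfeas : ∀ c y, y ∈ (LinProg.mk A b (Matrix.vecMul c M)).feasibleSet ↔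
      F.LPFeasible (y ∘ ev) := by
    intro c y
    rw [← F.lpFeasible_iff]
    have : ∀ p, (A.mulVec y) (er p) = ∑ k, F.coeff p k * (y ∘ ev) k := by
      intro p
      simp only [Matrix.mulVec, dotProduct, A, Equiv.symm_apply_apply]
      exact (Equiv.sum_comp ev _).symm.trans (by simp)
    simp only [LinProg.feasibleSet, Set.mem_ofPred_eq, ← this]
    constructor
    · intro h p
      simpa [b] using h (er p)
    · intro h i
      simpa [b] using h (er.symm i)
  have hobj : ∀ c y, (LinProg.mk A b (Matrix.vecMul c M)).obj ⬝ᵥ y = c ⬝ᵥ M.mulVec y :=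
    fun c y => (Matrix.dotProduct_mulVec c M y).symm
  have hM : ∀ α, F.Consistent α →
      M.mulVec (F.indicator α ∘ ev.symm) = fun j => (val j (α (node j)) / N : ℝ) := by
    intro α hα
    ext j
    rw [← F.sum_indicator hα (node j) fun z => (val j z / N : ℝ)]
    refine (Equiv.sum_comp ev.symm fun k : F.Var =>
      (if k.1 = node j then (val j k.2 / N : ℝ) else 0) * F.indicator α k).trans ?_
    rw [Fintype.sum_sigma, Finset.sum_eq_single (node j)]
    · simp [mul_comm]
    · intro i _ hi
      simp [hi]
    · simp
  have hind : ∀ c α, F.Consistent α →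
      F.indicator α ∘ ev.symm ∈ (LinProg.mk A b (Matrix.vecMul c M)).feasibleSet := by
    intro c α hα
    rw [hfeas]
    convert F.lpFeasible_indicator hα
    ext k
    simp
  refine ⟨_, _, A, b, M, F.card_var_add_card_row hq hcard, fun i k => F.coeff_mem _ _,
    fun i => F.rhs_mem _, fun j k => ?_, fun c => ?_⟩
  · by_cases h : (ev.symm k).1 = node j
    · exact ⟨val j (ev.symm k).2, hval j _ (h ▸ (ev.symm k).2.2), by simp [M, h]⟩
    · exact ⟨0, Nat.zero_le _, by simp [M, h]⟩
  · set L := LinProg.mk A b (Matrix.vecMul c M) with hL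
    refine ⟨hobj c, fun hne => ?_, fun x hx => ?_, fun y hy => ?_⟩
    · have hcl : IsClosed L.feasibleSet := by
        have : L.feasibleSet = ⋂ i, {y | L.b i ≤ (L.A.mulVec y) i} := by
          ext y; simp [LinProg.feasibleSet]
        rw [this]
        refine isClosed_iInter fun i => isClosed_le continuous_const ?_
        exact (continuous_apply i).comp (Continuous.matrix_mulVec continuous_const continuous_id)
      have hsub : L.feasibleSet ⊆ Set.Icc 0 1 := by
        intro y hy
        have hy := (hfeas c y).1 hy
        refine ⟨fun k => ?_, fun k => ?_⟩
        · simpa using hy.nonneg (ev.symm k)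
        · simpa using hy.le_one F (ev.symm k)
      have hcomp : IsCompact L.feasibleSet := isCompact_Icc.of_isClosed_subset hcl hsub
      obtain ⟨y, hy, hmin⟩ := hcomp.exists_isMinOn hne (f := fun y => L.obj ⬝ᵥ y)
        (by simp only [dotProduct]; fun_prop)
      exact ⟨y, hy, fun z hz => hmin hz⟩
    · obtain ⟨α, hα, hle⟩ := complete c x hx
      refine ⟨_, hind c α hα, ?_⟩
      rw [hobj, hM α hα]
      exact hle
    · obtain ⟨α, hα, y', hy', δ, hδ0, hδ1, heq⟩ :=
        F.exists_convex_combination ((hfeas c y).1 hy.1)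
      have hy'' : y' ∘ ev.symm ∈ L.feasibleSet := by
        rw [hfeas]
        convert hy'
        ext k
        simp
      have heq' : y = (1 - δ) • (y' ∘ ev.symm) + δ • (F.indicator α ∘ ev.symm) := by
        ext k
        simpa using congrFun heq (ev.symm k)
      refine ⟨fun j => val j (α (node j)) / N, sound α hα, ?_, fun hext => ?_⟩
      · rw [← hM α hα, ← hobj]
        -- The optimal value is a weighted mean of the values at `y'` and at the indicator. Neither
        -- is below it, so both equal it.
        refine le_antisymm ?_ (hy.2 _ (hind c α hα))
        have h1 := hy.2 _ hy''
        have h2 : L.obj ⬝ᵥ y = (1 - δ) * (L.obj ⬝ᵥ (y' ∘ ev.symm)) +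
            δ * (L.obj ⬝ᵥ (F.indicator α ∘ ev.symm)) := by
          conv_lhs => rw [heq']
          rw [dotProduct_add, dotProduct_smul, dotProduct_smul, smul_eq_mul, smul_eq_mul]
        have h3 : δ * (L.obj ⬝ᵥ (F.indicator α ∘ ev.symm)) ≤ δ * (L.obj ⬝ᵥ y) := by
          nlinarith
        exact le_of_mul_le_mul_left h3 hδ0
      · rw [← hM α hα]
        congr 1
        exact hext.2 (hind c α hα) hy'' ⟨δ, 1 - δ, hδ0, by linarith, by ring, by
          rw [heq', add_comm]⟩

/-! ### Rooted trees and their subtrees -/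

/-- A rooted tree, given by the parent function; the root is its own parent. -/
structure ParentTree (ι : Type*) where
  root : ι
  par : ι → ι
  dep : ι → ℕ
  par_root : par root = root
  dep_par : ∀ i, i ≠ root → dep (par i) < dep i

namespace ParentTree

variable {ι : Type*} (T : ParentTree ι)

/-- `W` induces a subtree with topmost node `t`. -/
def IsSubtree (W : Set ι) (t : ι) : Prop :=
  t ∈ W ∧ ∀ i ∈ W, i ≠ t → i ≠ T.root ∧ T.par i ∈ W

/-- `i` is an ancestor of `t`, or `t` itself. -/
def Anc (i t : ι) : Prop := ∃ k, T.par^[k] t = i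

variable {T}

lemma Anc.refl (i : ι) : T.Anc i i := ⟨0, rfl⟩

lemma Anc.trans {i j t : ι} (h : T.Anc i j) (h' : T.Anc j t) : T.Anc i t := by
  obtain ⟨k, rfl⟩ := h
  obtain ⟨l, rfl⟩ := h'
  exact ⟨k + l, Function.iterate_add_apply _ _ _ _⟩

lemma anc_par (i : ι) : T.Anc (T.par i) i := ⟨1, rfl⟩

lemma Anc.eq_or_par {i t : ι} (h : T.Anc i t) : t = i ∨ T.Anc i (T.par t) := by
  obtain ⟨k, hk⟩ := h
  cases k with
  | zero => exact Or.inl hk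
  | succ k => exact Or.inr ⟨k, by rwa [Function.iterate_succ_apply] at hk⟩

lemma dep_par_le (i : ι) : T.dep (T.par i) ≤ T.dep i := by
  by_cases h : i = T.root
  · rw [h, T.par_root]
  · exact (T.dep_par i h).le

lemma Anc.dep_le {i t : ι} (h : T.Anc i t) : T.dep i ≤ T.dep t := by
  obtain ⟨k, rfl⟩ := h
  induction k with
  | zero => exact le_rfl
  | succ k ih =>
    rw [Function.iterate_succ_apply']
    exact (dep_par_le _).trans ih

/-- Two ancestors of a node are comparable. -/
lemma Anc.total {i j t : ι} (hi : T.Anc i t) (hj : T.Anc j t) : T.Anc i j ∨ T.Anc j i := by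
  obtain ⟨k, rfl⟩ := hi
  obtain ⟨l, rfl⟩ := hj
  rcases le_total k l with h | h
  · right
    exact ⟨l - k, by rw [← Function.iterate_add_apply, Nat.sub_add_cancel h]⟩
  · left
    exact ⟨k - l, by rw [← Function.iterate_add_apply, Nat.sub_add_cancel h]⟩

/-- A proper descendant of `i` is a descendant of a child of `i`. -/
lemma Anc.exists_child {i t : ι} (h : T.Anc i t) (hne : t ≠ i) :
    ∃ c, c ≠ T.root ∧ T.par c = i ∧ T.Anc c t := by
  obtain ⟨k, hk⟩ := h
  induction k generalizing i with
  | zero => exact absurd hk hne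
  | succ k ih =>
    rw [Function.iterate_succ_apply'] at hk
    by_cases hr : T.par^[k] t = T.root
    · have : T.root = i := by rw [← hk, hr, T.par_root]
      exact ih hne (hr.trans this)
    · exact ⟨_, hr, hk, k, rfl⟩

/-- The child of `i` above a given node is unique. -/
lemma Anc.child_unique {c c' t : ι} (hc : c ≠ T.root) (hc' : c' ≠ T.root)
    (h : T.par c = T.par c') (ht : T.Anc c t) (ht' : T.Anc c' t) : c = c' := by
  have key : ∀ {c c' : ι}, c' ≠ T.root → c ≠ T.root → T.par c = T.par c' → T.Anc c c' →
      c = c' := by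
    intro c c' hc' hc h h'
    rcases h'.eq_or_par with h'' | h''
    · exact h''.symm
    · rw [← h] at h''
      exact absurd h''.dep_le (not_le.2 (T.dep_par c hc))
  rcases ht.total ht' with h' | h'
  · exact key hc' hc h h'
  · exact (key hc hc' h.symm h').symm

lemma IsSubtree.anc {W : Set ι} {t : ι} (h : T.IsSubtree W t) {i : ι} (hi : i ∈ W) :
    T.Anc t i := by
  induction hd : T.dep i using Nat.strong_induction_on generalizing i with
  | _ d ih =>
    by_cases hit : i = t
    · rw [hit]; exact Anc.refl _
    · obtain ⟨h1, h2⟩ := h.2 i hi hit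
      exact (ih _ (hd ▸ T.dep_par i h1) h2 rfl).trans (anc_par i)

/-- A node between the top of a subtree and one of its nodes belongs to the subtree. -/
lemma IsSubtree.mem_of_anc {W : Set ι} {t : ι} (h : T.IsSubtree W t) {i j : ι} (hi : i ∈ W)
    (hj : T.Anc j i) (htj : T.Anc t j) : j ∈ W := by
  induction hd : T.dep i using Nat.strong_induction_on generalizing i with
  | _ d ih =>
    rcases hj.eq_or_par with h' | h'
    · rwa [← h']
    · by_cases hit : i = t
      · subst hit
        have h1 := h'.dep_le
        have h2 := htj.dep_le
        by_cases hr : i = T.root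
        · rw [hr, T.par_root] at h'
          rcases htj.eq_or_par with h3 | h3
          · rwa [h3]
          · have : j = T.root := by
              by_contra hne
              have h4 := h'.dep_le
              have h5 := T.dep_par j hne
              have h6 := h3.dep_le
              rw [hr] at h6
              omega
            rw [this, ← hr]
            exact hi
        · have := T.dep_par i hr
          omega
      · obtain ⟨h1, h2⟩ := h.2 i hi hit
        exact ih _ (hd ▸ T.dep_par i h1) h2 h' rfl

end ParentTree

namespace SimpleGraph

variable {ι : Type*} {G : SimpleGraph ι}

/-- Rooting a tree at a node. -/
lemma IsTree.exists_parentTree (hG : G.IsTree) :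
    ∃ T : ParentTree ι, ∀ v w, G.Adj v w → T.par v = w ∨ T.par w = v := by
  obtain ⟨r⟩ := hG.connected.nonempty
  have := fun w => (hG.existsUnique_path r w).exists
  choose p hp using this
  have hr : p r = Walk.nil := (Walk.isPath_iff_nil.1 (hp r)).eq_nil
  refine ⟨⟨r, fun w => (p w).penultimate, fun w => (p w).length, by simp [hr],
    fun i hi => ?_⟩, fun v w hvw => ?_⟩
  · have hnil : ¬ (p i).Nil := Walk.not_nil_of_ne (Ne.symm hi)
    have := hG.isAcyclic.path_concat (hp _) (hp i) ((p i).adj_penultimate hnil)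
      ((p i).getVert_mem_support _)
    have h2 := congrArg Walk.length this
    rw [Walk.length_concat] at h2
    show (p (p i).penultimate).length < (p i).length
    omega
  · by_cases hw : w ∈ (p v).support
    · exact Or.inl (hG.isAcyclic.eq_penultimate_of_adj_end (hp v) hvw hw).symm
    · right
      exact (hG.isAcyclic.eq_penultimate_of_adj_end (hp w) hvw.symm
        (hG.isAcyclic.mem_support_of_ne_mem_support_of_adj_of_isPath (hp w) (hp v)
          hvw.symm hw)).symm

end SimpleGraph

/-- A nonempty connected set of nodes of a tree is a subtree. -/
lemma ParentTree.exists_isSubtree {ι : Type*} {G : SimpleGraph ι} (T : ParentTree ι)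
    (hT : ∀ v w, G.Adj v w → T.par v = w ∨ T.par w = v) (W : Set ι) (hne : W.Nonempty)
    (hW : (G.induce W).Preconnected) : ∃ t, T.IsSubtree W t := by
  obtain ⟨t, ht, hmin⟩ : ∃ t ∈ W, ∀ s ∈ W, T.dep t ≤ T.dep s := by
    obtain ⟨t, ht⟩ := exists_minimal_of_wellFoundedLT (fun k => ∃ t ∈ W, T.dep t = k)
      ⟨_, hne.some, hne.some_mem, rfl⟩
    obtain ⟨⟨t, htW, rfl⟩, h2⟩ := ht
    exact ⟨t, htW, fun s hs => le_of_not_gt fun hlt =>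
      absurd (h2 ⟨s, hs, rfl⟩ hlt.le) (not_le.2 hlt)⟩
  -- Along a walk inside `W`, the invariant is that the ascent from the current node reaches `t`
  -- without leaving `W`. Stepping down to a child lengthens this ascent by one node, stepping up
  -- shortens it; stepping above `t` contradicts minimal depth.
  have key : ∀ a b : W, (G.induce W).Reachable a b →
      (∃ k, T.par^[k] a = t ∧ ∀ l ≤ k, T.par^[l] a ∈ W) →
      ∃ k, T.par^[k] b = t ∧ ∀ l ≤ k, T.par^[l] b ∈ W := by
    rintro a b ⟨w⟩
    induction w with
    | nil => exact id
    | @cons a b c hab _ ih =>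
      rintro ⟨k, hk, hl⟩
      apply ih
      have hab' : G.Adj a b := hab
      rcases hT _ _ hab' with h | h
      · cases k with
        | zero =>
          have hk : (a : ι) = t := hk
          have hne : (a : ι) ≠ T.root := by
            intro h0
            rw [h0, T.par_root] at h
            exact hab'.ne (h0.trans h)
          have h1 := T.dep_par _ hne
          have h2 := hmin b b.2
          rw [h, hk] at h1
          omega
        | succ k =>
          rw [Function.iterate_succ_apply, h] at hk
          refine ⟨k, hk, fun l hlk => ?_⟩
          have := hl (l + 1) (by omega)
          rwa [Function.iterate_succ_apply, h] at this
      · refine ⟨k + 1, by rwa [Function.iterate_succ_apply, h], fun l hlk => ?_⟩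
        cases l with
        | zero => exact b.2
        | succ l =>
          rw [Function.iterate_succ_apply, h]
          exact hl l (by omega)
  refine ⟨t, ht, fun i hi hit => ?_⟩
  obtain ⟨k, hk, hl⟩ := key ⟨t, ht⟩ ⟨i, hi⟩ (hW _ _)
    ⟨0, rfl, fun l hl => by obtain rfl := Nat.le_zero.1 hl; exact ht⟩
  cases k with
  | zero => exact absurd hk hit
  | succ k =>
    refine ⟨fun h => hit ?_, hl 1 (by omega)⟩
    change T.par^[k + 1] i = t at hk
    rw [h] at hk ⊢
    rwa [Function.iterate_fixed T.par_root] at hk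

/-! ### Binary trees by the first-child, next-sibling encoding -/

namespace ParentTree

variable {ι : Type*}

/-- The tree whose edges at a node lead to at most two children: `side` tells them apart. -/
def IsBinary (T : ParentTree ι) : Prop :=
  ∃ side : ι → Bool, ∀ i j, i ≠ T.root → j ≠ T.root → T.par i = T.par j → side i = side j → i = j

/-- The binary tree in which the first child of a node stays its child, and any other child becomes
a child of its previous sibling. Subtrees are enlarged by the children of their nodes. -/
lemma exists_isBinary [Finite ι] (T : ParentTree ι) :
    ∃ T' : ParentTree ι, T'.IsBinary ∧
      ∀ W t, T.IsSubtree W t → T'.IsSubtree {i | i ∈ W ∨ T.par i ∈ W} t := by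
  classical
  obtain ⟨B, ⟨e⟩⟩ := Finite.exists_equiv_fin ι
  have hpos : ∀ i : ι, 0 < B := fun i => (Nat.zero_le _).trans_lt (e i).2
  have hprev : ∀ c, ∃ p, (c = T.root → p = T.root) ∧ (c ≠ T.root →
      (p ≠ T.root ∧ T.par p = T.par c ∧ e p < e c ∧
        ∀ s, s ≠ T.root → T.par s = T.par c → e s < e c → e s ≤ e p) ∨
      (p = T.par c ∧ ∀ s, s ≠ T.root → T.par s = T.par c → ¬ e s < e c)) := by
    intro c
    by_cases hc : c = T.root
    · exact ⟨T.root, fun _ => rfl, fun h => absurd hc h⟩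
    by_cases h : ∃ s, s ≠ T.root ∧ T.par s = T.par c ∧ e s < e c
    · obtain ⟨s, hs⟩ := h
      obtain ⟨p, hp, hmax⟩ := Set.exists_max_image
        {s | s ≠ T.root ∧ T.par s = T.par c ∧ e s < e c} e (Set.toFinite _) ⟨s, hs⟩
      exact ⟨p, fun h => absurd h hc, fun _ => Or.inl ⟨hp.1, hp.2.1, hp.2.2,
        fun s h1 h2 h3 => hmax s ⟨h1, h2, h3⟩⟩⟩
    · push Not at h
      exact ⟨T.par c, fun h => absurd h hc, fun _ => Or.inr ⟨rfl, fun s h1 h2 =>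
        not_lt.2 (h s h1 h2)⟩⟩
  choose bp hroot hbp using hprev
  -- Lexicographic order by the depth of the old parent and then by position among siblings, coded
  -- in base `B`. The summand 1 places every other node above the value 0 of the root.
  let dep' : ι → ℕ := fun i => if i = T.root then 0 else (T.dep (T.par i) + 1) * B + e i
  have hdep' : ∀ i, i ≠ T.root → dep' (bp i) < dep' i := by
    intro i hi
    simp only [dep', if_neg hi]
    rcases hbp i hi with ⟨h1, h2, h3, -⟩ | ⟨h1, -⟩
    · rw [if_neg h1, h2]
      have : (e (bp i) : ℕ) < e i := h3
      omega
    · rw [h1]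
      split_ifs with h
      · have := hpos i
        positivity
      · have h2 := T.dep_par _ h
        have h3 := (e (T.par i)).2
        have : (T.dep (T.par (T.par i)) + 1) * B ≤ T.dep (T.par i) * B :=
          Nat.mul_le_mul_right _ h2
        rw [add_mul (T.dep (T.par i))]
        omega
  -- The side tells whether the new parent is the previous sibling or the old parent. The root must
  -- be excluded explicitly: being its own parent, it would look like a sibling of its children.
  refine ⟨⟨T.root, bp, dep', hroot _ rfl, hdep'⟩, ⟨fun i => decide (T.par (bp i) = T.par i ∧
    e (bp i) < e i ∧ bp i ≠ T.root), ?_⟩, ?_⟩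
  · intro i j hi hj hij hside
    change i ≠ T.root at hi
    change j ≠ T.root at hj
    change bp i = bp j at hij
    simp only [decide_eq_decide] at hside
    by_cases h : T.par (bp i) = T.par i ∧ e (bp i) < e i ∧ bp i ≠ T.root
    · have h' := hside.1 h
      apply e.injective
      have h1 : T.par i = T.par j := by rw [← h.1, ← h'.1, hij]
      rcases hbp i hi with ⟨_, _, _, a⟩ | ⟨_, a⟩
      · rcases hbp j hj with ⟨_, _, _, b⟩ | ⟨_, b⟩
        · by_contra hne
          rcases lt_or_gt_of_ne hne with h2 | h2
          · have := b i hi h1 h2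
            rw [← hij] at this
            exact absurd h.2.1 (not_lt.2 this)
          · have := a j hj h1.symm h2
            rw [hij] at this
            exact absurd h'.2.1 (not_lt.2 this)
        · exact absurd h'.2.1 (b _ h'.2.2 h'.1)
      · exact absurd h.2.1 (a _ h.2.2 h.1)
    · have h' := fun h' => h (hside.2 h')
      rcases hbp i hi with ⟨a1, a2, a3, -⟩ | ⟨a1, a2⟩
      · exact absurd ⟨a2, a3, a1⟩ h
      rcases hbp j hj with ⟨b1, b2, b3, -⟩ | ⟨b1, b2⟩
      · exact absurd ⟨b2, b3, b1⟩ h'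
      have h1 : T.par i = T.par j := by rw [← a1, ← b1, hij]
      exact e.injective (le_antisymm (not_lt.1 (a2 j hj h1.symm)) (not_lt.1 (b2 i hi h1)))
  · intro W t hW
    refine ⟨Or.inl hW.1, fun i hi hit => ?_⟩
    have h1 : i ≠ T.root ∧ T.par i ∈ W := by
      by_cases hiW : i ∈ W
      · exact hW.2 i hiW hit
      · have h2 : T.par i ∈ W := hi.resolve_left hiW
        refine ⟨fun h => hiW ?_, h2⟩
        rw [h, T.par_root] at h2
        rwa [h]
    refine ⟨h1.1, ?_⟩
    show bp i ∈ W ∨ T.par (bp i) ∈ W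
    rcases hbp i h1.1 with ⟨_, h2, _⟩ | ⟨h2, _⟩
    · right; rw [h2]; exact h1.2
    · left; rw [h2]; exact h1.2

end ParentTree

/-! ### Trees carrying a network problem, and their contraction -/

/-- A rooted tree that carries a network problem: the variables and the vertices of the network are
represented by subtrees, and each pair `(u, v)` of adjacent vertices is located at a node of the
subtree of `u` where all variables of `u` and `v` are present. -/
structure NetworkDecomp {V : Type*} {n : ℕ} (P : NPO V n) (ι : Type*) extends ParentTree ι where
  vars : ι → Finset (Fin n)
  varTop : Fin n → ι
  vars_subtree : ∀ j, toParentTree.IsSubtree {i | j ∈ vars i} (varTop j)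
  verts : V → Set ι
  vertTop : V → ι
  verts_subtree : ∀ u, toParentTree.IsSubtree (verts u) (vertTop u)
  loc : V → V → ι
  loc_mem : ∀ u v, P.graph.Adj u v → loc u v ∈ verts u
  loc_vars : ∀ u v, P.graph.Adj u v → P.X u ∪ P.X v ⊆ vars (loc u v)

namespace NetworkDecomp

variable {V : Type*} {n : ℕ} {P : NPO V n} {ι : Type*}

/-- The subtree of `u` contains `i` and the parent of `i`. -/
def Crosses (D : NetworkDecomp P ι) (u : V) (i : ι) : Prop := i ∈ D.verts u ∧ i ≠ D.vertTop u

/-- Contraction of an edge from `i` to its parent. -/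
noncomputable def contractMap (D : NetworkDecomp P ι) (i : ι) (hi : i ≠ D.root) (c : ι) :
    {t // t ≠ i} :=
  open scoped Classical in
  if h : c = i then ⟨D.par i, fun h' => by have := D.dep_par i hi; rw [h'] at this; omega⟩
  else ⟨c, h⟩

lemma contractMap_self (D : NetworkDecomp P ι) (i : ι) (hi : i ≠ D.root) :
    (D.contractMap i hi i : ι) = D.par i := by
  simp [contractMap]

lemma contractMap_of_ne (D : NetworkDecomp P ι) {i : ι} (hi : i ≠ D.root) {c : ι} (h : c ≠ i) :
    D.contractMap i hi c = ⟨c, h⟩ := by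
  simp [contractMap, h]

/-- Only the node `i` moves, and it moves to its parent, which already belongs to `W` unless `i` is
the top of `W`. Hence contraction adds at most a new top to a subtree. -/
lemma mem_of_contractMap (D : NetworkDecomp P ι) {i : ι} (hi : i ≠ D.root) {W : Set ι} {t : ι}
    (hW : D.IsSubtree W t) (c : {t // t ≠ i}) (hc : c ∈ D.contractMap i hi '' W)
    (hct : c ≠ D.contractMap i hi t) : (c : ι) ∈ W ∧ (c : ι) ≠ t := by
  have hne : (c : ι) ≠ t := by
    intro h
    apply hct
    rw [← h, D.contractMap_of_ne hi c.2]
  refine ⟨?_, hne⟩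
  obtain ⟨a, ha, rfl⟩ := hc
  by_cases h : a = i
  · subst h
    rw [contractMap_self]
    exact (hW.2 a ha fun h => hct (congrArg _ h)).2
  · rwa [D.contractMap_of_ne hi h]

/-- Contraction of the edge from a node, at which no variable has its top, to its parent. -/
noncomputable def contract (D : NetworkDecomp P ι) (i : ι) (hi : i ≠ D.root)
    (hv : ∀ j, D.varTop j ≠ i) : NetworkDecomp P {t // t ≠ i} where
  root := ⟨D.root, hi.symm⟩
  par c := D.contractMap i hi (D.par c)
  dep c := D.dep c
  par_root := by
    rw [D.par_root, D.contractMap_of_ne hi hi.symm]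
  dep_par c hc := by
    have h1 := D.dep_par c fun h => hc (Subtype.ext h)
    by_cases h : D.par c = i
    · rw [h, contractMap_self]
      rw [h] at h1
      exact (ParentTree.dep_par_le _).trans_lt h1
    · rwa [D.contractMap_of_ne hi h]
  vars c := D.vars c
  varTop j := ⟨D.varTop j, hv j⟩
  vars_subtree j := by
    refine ⟨(D.vars_subtree j).1, fun c hc hct => ?_⟩
    obtain ⟨h1, h2⟩ := (D.vars_subtree j).2 c hc fun h => hct (Subtype.ext h)
    refine ⟨fun h => h1 (congrArg Subtype.val h), ?_⟩
    show j ∈ D.vars (D.contractMap i hi (D.par c))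
    by_cases h : D.par c = i
    · rw [h, contractMap_self]
      rw [h] at h2
      exact ((D.vars_subtree j).2 i h2 (hv j).symm).2
    · rwa [D.contractMap_of_ne hi h]
  verts u := D.contractMap i hi '' D.verts u
  vertTop u := D.contractMap i hi (D.vertTop u)
  verts_subtree u := by
    refine ⟨⟨_, (D.verts_subtree u).1, rfl⟩, fun c hc hct => ?_⟩
    obtain ⟨h1, h2⟩ := D.mem_of_contractMap hi (D.verts_subtree u) c hc hct
    obtain ⟨h3, h4⟩ := (D.verts_subtree u).2 c h1 h2
    exact ⟨fun h => h3 (congrArg Subtype.val h), _, h4, rfl⟩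
  loc u v := D.contractMap i hi (D.loc u v)
  loc_mem u v h := ⟨_, D.loc_mem u v h, rfl⟩
  loc_vars u v h := by
    refine (D.loc_vars u v h).trans fun j hj => ?_
    by_cases h : D.loc u v = i
    · rw [h, contractMap_self]
      rw [h] at hj
      exact ((D.vars_subtree j).2 i hj (hv j).symm).2
    · rwa [D.contractMap_of_ne hi h]

/-- The node `i` has at most one child, which inherits the side that `i` had at its parent. -/
lemma contract_isBinary (D : NetworkDecomp P ι) (i : ι) (hi : i ≠ D.root)
    (hv : ∀ j, D.varTop j ≠ i) (hD : D.IsBinary)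
    (hc : ∀ c c', c ≠ D.root → c' ≠ D.root → D.par c = i → D.par c' = i → c = c') :
    (D.contract i hi hv).IsBinary := by
  classical
  obtain ⟨side, hside⟩ := hD
  refine ⟨fun c => if D.par c = i then side i else side c, fun c c' hcr hcr' hcc hs => ?_⟩
  have hcr : (c : ι) ≠ D.root := fun h => hcr (Subtype.ext h)
  have hcr' : (c' : ι) ≠ D.root := fun h => hcr' (Subtype.ext h)
  have hcc : D.contractMap i hi (D.par c) = D.contractMap i hi (D.par c') := hcc
  have hcc := congrArg Subtype.val hcc
  apply Subtype.ext
  by_cases h : D.par c = i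
  · by_cases h' : D.par c' = i
    · exact hc _ _ hcr hcr' h h'
    · rw [h, contractMap_self, D.contractMap_of_ne hi h'] at hcc
      simp only [if_pos h, if_neg h'] at hs
      exact absurd (hside _ _ hi hcr' hcc hs) c'.2.symm
  · by_cases h' : D.par c' = i
    · rw [h', contractMap_self, D.contractMap_of_ne hi h] at hcc
      simp only [if_pos h', if_neg h] at hs
      exact absurd (hside _ _ hcr hi hcc hs) c.2
    · rw [D.contractMap_of_ne hi h, D.contractMap_of_ne hi h'] at hcc
      simp only [if_neg h', if_neg h] at hs
      exact hside _ _ hcr hcr' hcc hs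

/-- The size of the data that a node shares with its parent. -/
noncomputable def weight [Fintype V] (D : NetworkDecomp P ι) (i : ι) : ℕ :=
  open scoped Classical in (D.vars i).card + ∑ u with D.Crosses u i, P.K u

/-- Contraction lets a subtree grow only at its top, and the top does not cross to its parent. This
is why the weight counts crossing vertices and not all vertices whose subtree contains the node. -/
lemma contract_weight [Fintype V] (D : NetworkDecomp P ι) (i : ι) (hi : i ≠ D.root)
    (hv : ∀ j, D.varTop j ≠ i) (c : {t // t ≠ i}) :
    (D.contract i hi hv).weight c ≤ D.weight c := by
  classical
  refine Nat.add_le_add_left (Finset.sum_le_sum_of_subset fun u hu => ?_) _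
  simp only [Finset.mem_filter, Finset.mem_univ, true_and] at hu ⊢
  exact D.mem_of_contractMap hi (D.verts_subtree u) c hu.1 hu.2

/-- A binary tree in which every node, apart from the root and at most `n` others, has two children
has at most `2 n + 1` nodes. -/
lemma card_le_of_two_children [Fintype ι] (D : NetworkDecomp P ι)
    (h : ∀ i, i ≠ D.root → (∀ j, D.varTop j ≠ i) →
      ∃ c c', c ≠ D.root ∧ c' ≠ D.root ∧ D.par c = i ∧ D.par c' = i ∧ c ≠ c') :
    Fintype.card ι ≤ 2 * n + 1 := by
  classical
  let U : Finset ι := (Finset.univ.erase D.root) \ Finset.univ.image D.varTop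
  have hU : Fintype.card ι - 1 - n ≤ U.card := by
    refine le_trans ?_ (Finset.le_card_sdiff _ _)
    rw [Finset.card_erase_of_mem (Finset.mem_univ _), Finset.card_univ]
    have : (Finset.univ.image D.varTop).card ≤ n := Finset.card_image_le.trans (by simp)
    omega
  -- Double counting of children: every node other than the root is a child of exactly one node.
  have h2 : 2 * U.card ≤ (Finset.univ.erase D.root).card := by
    calc 2 * U.card = ∑ i ∈ U, 2 := by simp [mul_comm]
      _ ≤ ∑ i ∈ U, ((Finset.univ.erase D.root).filter fun c => D.par c = i).card := by
        refine Finset.sum_le_sum fun i hi => ?_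
        simp only [U, Finset.mem_sdiff, Finset.mem_erase, Finset.mem_univ, and_true,
          Finset.mem_image, true_and, not_exists] at hi
        obtain ⟨c, c', h1, h2, h3, h4, h5⟩ := h i hi.1 hi.2
        rw [← Finset.card_pair h5]
        refine Finset.card_le_card fun x hx => ?_
        rcases Finset.mem_insert.1 hx with rfl | hx
        · simp [h1, h3]
        · rw [Finset.mem_singleton.1 hx]
          simp [h2, h4]
      _ ≤ ∑ i, ((Finset.univ.erase D.root).filter fun c => D.par c = i).card :=
        Finset.sum_le_sum_of_subset (Finset.subset_univ _)
      _ = _ := (Finset.card_eq_sum_card_fiberwise fun _ _ => by simp).symm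
  rw [Finset.card_erase_of_mem (Finset.mem_univ _), Finset.card_univ] at h2
  omega

/-- Contraction makes the size of a binary decomposition linear in the number of variables. -/
lemma exists_card_le [Fintype V] {w : ℕ} (k : ℕ) {ι : Type} [Fintype ι] (hk : Fintype.card ι = k)
    (D : NetworkDecomp P ι) (hD : D.IsBinary) (hw : ∀ i, D.weight i ≤ w) :
    ∃ (ι' : Type) (_ : Fintype ι') (D' : NetworkDecomp P ι'), D'.IsBinary ∧
      (∀ i, D'.weight i ≤ w) ∧ Fintype.card ι' ≤ 2 * n + 1 := by
  classical
  induction k using Nat.strong_induction_on generalizing ι with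
  | _ k ih =>
    by_cases h : ∀ i, i ≠ D.root → (∀ j, D.varTop j ≠ i) →
      ∃ c c', c ≠ D.root ∧ c' ≠ D.root ∧ D.par c = i ∧ D.par c' = i ∧ c ≠ c'
    · exact ⟨ι, inferInstance, D, hD, hw, D.card_le_of_two_children h⟩
    · push Not at h
      obtain ⟨i, hi, hv, hc⟩ := h
      refine ih _ ?_ rfl (D.contract i hi hv) (D.contract_isBinary i hi hv hD hc)
        fun c => (D.contract_weight i hi hv c).trans (hw c)
      rw [← hk]
      exact Fintype.card_subtype_lt (x := i) (by simp)

/-- The passage to a binary tree at most doubles the sizes. -/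
lemma exists_binary [Fintype V] [Finite ι] (D : NetworkDecomp P ι) {w : ℕ}
    (hw : open scoped Classical in
      ∀ i, (D.vars i).card + ∑ u with i ∈ D.verts u, P.K u ≤ w) :
    ∃ D' : NetworkDecomp P ι, D'.IsBinary ∧ ∀ i, D'.weight i ≤ 2 * w := by
  classical
  obtain ⟨T, hT, hsub⟩ := D.exists_isBinary
  refine ⟨{ toParentTree := T
            vars := fun i => D.vars i ∪ D.vars (D.par i)
            varTop := D.varTop
            vars_subtree := fun j => by
              convert hsub _ _ (D.vars_subtree j) using 1
              ext
              simp
            verts := fun u => {i | i ∈ D.verts u ∨ D.par i ∈ D.verts u}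
            vertTop := D.vertTop
            verts_subtree := fun u => hsub _ _ (D.verts_subtree u)
            loc := D.loc
            loc_mem := fun u v h => Or.inl (D.loc_mem u v h)
            loc_vars := fun u v h => (D.loc_vars u v h).trans Finset.subset_union_left },
    hT, fun i => ?_⟩
  have h1 : (D.vars i ∪ D.vars (D.par i)).card ≤ (D.vars i).card + (D.vars (D.par i)).card :=
    Finset.card_union_le _ _
  have h2 := hw i
  have h3 := hw (D.par i)
  unfold weight
  -- If the enlarged subtree of `u` contains `i` below its top, the old one contains the old parent
  -- of `i`. So the crossing vertices are all charged to that one node.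
  refine (Nat.add_le_add h1 (Finset.sum_le_sum_of_subset (t := Finset.univ.filter fun u =>
    D.par i ∈ D.verts u) fun u hu => ?_)).trans (by omega)
  simp only [Finset.mem_filter, Finset.mem_univ, true_and] at hu ⊢
  obtain ⟨hu1, hu2⟩ := hu
  rcases hu1 with hu1 | hu1
  · exact ((D.verts_subtree u).2 i hu1 hu2).2
  · exact hu1

end NetworkDecomp

/-! ### From a tree-decomposition to a carrying tree -/

/-- The nodes whose bags contain a vertex of a nonempty connected set of vertices. -/
lemma TreeDecomposition.preconnected_induce {V : Type*} {G : SimpleGraph V}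
    (T : TreeDecomposition G) (A : Set V) (hA : (G.induce A).Preconnected) :
    (T.tree.induce {t | ∃ v ∈ A, v ∈ T.bag t}).Preconnected := by
  set W : Set (Fin T.nodes) := {t | ∃ v ∈ A, v ∈ T.bag t}
  have h1 : ∀ v (_ : v ∈ A) s t (hs : v ∈ T.bag s) (ht : v ∈ T.bag t) (hs' : s ∈ W) (ht' : t ∈ W),
      (T.tree.induce W).Reachable ⟨s, hs'⟩ ⟨t, ht'⟩ := by
    intro v hv s t hs ht hs' ht'
    have := (T.subtree v).preconnected ⟨s, hs⟩ ⟨t, ht⟩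
    exact this.map (SimpleGraph.induceHomOfLE T.tree (s := {t | v ∈ T.bag t}) (s' := W)
      fun t ht => ⟨v, hv, ht⟩).toHom
  have h2 : ∀ a b : A, (G.induce A).Reachable a b → ∀ s t (hs : (a : V) ∈ T.bag s)
      (ht : (b : V) ∈ T.bag t) (hs' : s ∈ W) (ht' : t ∈ W),
      (T.tree.induce W).Reachable ⟨s, hs'⟩ ⟨t, ht'⟩ := by
    rintro a b ⟨w⟩
    induction w with
    | @nil a => exact h1 a a.2
    | @cons a b c hab _ ih =>
      intro s t hs ht hs' ht'
      obtain ⟨r, hr1, hr2⟩ := T.edge a b hab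
      exact (h1 a a.2 s r hs hr1 hs' ⟨a, a.2, hr1⟩).trans
        (ih r t hr2 ht ⟨a, a.2, hr1⟩ ht')
  rintro ⟨s, a, ha, hs⟩ ⟨t, b, hb, ht⟩
  exact h2 ⟨a, ha⟩ ⟨b, hb⟩ (hA _ _) s t hs ht _ _

/-- Adding leaves below the root. -/
def ParentTree.addLeaves {ι : Type*} (T : ParentTree ι) (κ : Type*) : ParentTree (ι ⊕ κ) where
  root := .inl T.root
  par := Sum.elim (fun i => .inl (T.par i)) fun _ => .inl T.root
  dep := Sum.elim T.dep fun _ => T.dep T.root + 1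
  par_root := by simp [T.par_root]
  dep_par i hi := by
    rcases i with i | i
    · exact T.dep_par i fun h => hi (congrArg _ h)
    · exact Nat.lt_succ_self _

lemma ParentTree.IsSubtree.addLeaves {ι : Type*} {T : ParentTree ι} {W : Set ι} {t : ι}
    (h : T.IsSubtree W t) (κ : Type*) : (T.addLeaves κ).IsSubtree (Sum.inl '' W) (.inl t) := by
  refine ⟨⟨t, h.1, rfl⟩, ?_⟩
  rintro _ ⟨i, hi, rfl⟩ hit
  obtain ⟨h1, h2⟩ := h.2 i hi fun h => hit (congrArg _ h)
  exact ⟨fun h => h1 (Sum.inl_injective h), _, h2, rfl⟩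

/-- A network problem over a graph of tree-width at most `ω` is carried by a tree. -/
lemma NPO.exists_networkDecomp {V : Type*} [Fintype V] {n ω Δ : ℕ} (P : NPO V n)
    (hω : TreeWidthLE P.graph ω) (hΔ : ∀ u, (P.X u).card + P.K u ≤ Δ) (hΔ1 : 1 ≤ Δ) :
    open scoped Classical in
    ∃ (ι : Type) (_ : Fintype ι) (D : NetworkDecomp P ι),
      ∀ i, (D.vars i).card + ∑ u with i ∈ D.verts u, P.K u ≤ (ω + 1) * Δ := by
  classical
  obtain ⟨TD, hbag⟩ := hω
  obtain ⟨T, hT⟩ := TD.isTree.exists_parentTree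
  have hv : ∀ v, ∃ t, T.IsSubtree {t | v ∈ TD.bag t} t := fun v =>
    T.exists_isSubtree hT _ (Set.nonempty_coe_sort.1 (TD.subtree v).nonempty)
      (TD.subtree v).preconnected
  have hj : ∀ j, ∃ t, (∃ v, j ∈ P.X v) → T.IsSubtree {t | ∃ v ∈ {v | j ∈ P.X v}, v ∈ TD.bag t} t := by
    intro j
    by_cases h : ∃ v, j ∈ P.X v
    · obtain ⟨v, hjv⟩ := h
      obtain ⟨t, ht⟩ := (TD.subtree v).nonempty
      obtain ⟨t', ht'⟩ := T.exists_isSubtree hT _ ⟨t, by exact ⟨v, hjv, ht⟩⟩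
        (TD.preconnected_induce {v | j ∈ P.X v} (P.X_connected j))
      exact ⟨t', fun _ => ht'⟩
    · exact ⟨T.root, fun h' => absurd h' h⟩
  have hl : ∀ u v, ∃ t, P.graph.Adj u v → u ∈ TD.bag t ∧ v ∈ TD.bag t := by
    intro u v
    by_cases h : P.graph.Adj u v
    · obtain ⟨t, ht⟩ := TD.edge u v h
      exact ⟨t, fun _ => ht⟩
    · exact ⟨T.root, fun h' => absurd h' h⟩
  choose vt hvt using hv
  choose jt hjt using hj
  choose l hl using hl
  -- A variable associated with no vertex occurs in no bag but still needs a nonempty subtree; it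
  -- gets a leaf of its own. The leaves of the other variables stay empty.
  have hvars : ∀ j, (T.addLeaves (Fin n)).IsSubtree
      {i | j ∈ (Sum.elim (fun t => (TD.bag t).biUnion P.X)
        (fun j' => if ∃ v, j' ∈ P.X v then ∅ else {j'}) i : Finset (Fin n))}
      (if ∃ v, j ∈ P.X v then .inl (jt j) else .inr j) := by
    intro j
    by_cases h : ∃ v, j ∈ P.X v
    · rw [if_pos h]
      convert (hjt j h).addLeaves (Fin n) using 1
      ext i
      rcases i with t | j'
      · simp [and_comm]
      · simp only [Set.mem_ofPred_eq, Sum.elim_inr, Set.mem_image, reduceCtorEq, and_false,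
          exists_false, iff_false]
        split_ifs with h'
        · simp
        · rintro hh
          rw [Finset.mem_singleton.1 hh] at h
          exact h' h
    · rw [if_neg h]
      refine ⟨by simp [h], ?_⟩
      rintro (t | j') hi hne
      · simp only [Set.mem_ofPred_eq, Sum.elim_inl, Finset.mem_biUnion] at hi
        obtain ⟨v, _, hv⟩ := hi
        exact absurd ⟨v, hv⟩ h
      · simp only [Set.mem_ofPred_eq, Sum.elim_inr] at hi
        split_ifs at hi with h'
        · simp at hi
        · exact absurd (congrArg _ (Finset.mem_singleton.1 hi).symm) hne
  refine ⟨Fin TD.nodes ⊕ Fin n, inferInstance,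
    { toParentTree := T.addLeaves (Fin n)
      vars := Sum.elim (fun t => (TD.bag t).biUnion P.X)
        (fun j' => if ∃ v, j' ∈ P.X v then ∅ else {j'})
      varTop := fun j => if ∃ v, j ∈ P.X v then .inl (jt j) else .inr j
      vars_subtree := hvars
      verts := fun u => Sum.inl '' {t | u ∈ TD.bag t}
      vertTop := fun u => .inl (vt u)
      verts_subtree := fun u => (hvt u).addLeaves _
      loc := fun u v => .inl (l u v)
      loc_mem := fun u v h => ⟨_, (hl u v h).1, rfl⟩
      loc_vars := fun u v h => Finset.union_subset
        (Finset.subset_biUnion_of_mem P.X (hl u v h).1)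
        (Finset.subset_biUnion_of_mem P.X (hl u v h).2) }, ?_⟩
  rintro (t | j)
  · have h1 : (Finset.univ.filter fun u => Sum.inl t ∈
        (Sum.inl '' {t | u ∈ TD.bag t} : Set (Fin TD.nodes ⊕ Fin n))) = TD.bag t := by
      ext u; simp
    simp only [h1, Sum.elim_inl]
    calc _ ≤ ∑ u ∈ TD.bag t, (P.X u).card + ∑ u ∈ TD.bag t, P.K u :=
          Nat.add_le_add_right Finset.card_biUnion_le _
      _ = ∑ u ∈ TD.bag t, ((P.X u).card + P.K u) := Finset.sum_add_distrib.symm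
      _ ≤ (TD.bag t).card * Δ := Finset.sum_le_card_nsmul _ _ _ fun u _ => hΔ u
      _ ≤ (ω + 1) * Δ := Nat.mul_le_mul_right _ (hbag t)
  · have h1 : (Finset.univ.filter fun u => Sum.inr j ∈
        (Sum.inl '' {t | u ∈ TD.bag t} : Set (Fin TD.nodes ⊕ Fin n))) = ∅ := by
      ext u; simp
    simp only [h1, Sum.elim_inr, Finset.sum_empty, add_zero]
    calc _ ≤ 1 := by split_ifs <;> simp
      _ ≤ (ω + 1) * Δ := by nlinarith

/-! ### Gluing integer points along the tree -/

open scoped Classical in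
/-- A node is either `i` itself or lies below exactly one child of `i`. -/
lemma ParentTree.ite_anc_eq {ι M : Type*} [Fintype ι] [AddCommMonoid M] (T : ParentTree ι)
    (i t : ι) (g : M) :
    (if T.Anc i t then g else 0) = (if t = i then g else 0) +
      ∑ c with c ≠ T.root ∧ T.par c = i, if T.Anc c t then g else 0 := by
  by_cases hti : t = i
  · subst hti
    rw [if_pos (Anc.refl t), if_pos rfl, Finset.sum_eq_zero, add_zero]
    intro c hc
    obtain ⟨h1, h2⟩ := (Finset.mem_filter.1 hc).2
    rw [if_neg]
    intro h
    have h3 := h.dep_le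
    have h4 := T.dep_par c h1
    rw [h2] at h4
    omega
  · rw [if_neg hti, zero_add]
    by_cases h : T.Anc i t
    · obtain ⟨c, hc1, hc2, hc3⟩ := h.exists_child hti
      rw [if_pos h, Finset.sum_eq_single c, if_pos hc3]
      · intro c' hc' hne
        obtain ⟨h1, h2⟩ := (Finset.mem_filter.1 hc').2
        rw [if_neg]
        intro h3
        exact hne (Anc.child_unique h1 hc1 (h2.trans hc2.symm) h3 hc3)
      · intro hn
        exact absurd (Finset.mem_filter.2 ⟨Finset.mem_univ _, hc1, hc2⟩) hn
    · rw [if_neg h, Finset.sum_eq_zero]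
      intro c hc
      obtain ⟨h1, h2⟩ := (Finset.mem_filter.1 hc).2
      rw [if_neg]
      intro h3
      exact h ((h2 ▸ anc_par c : T.Anc i c).trans h3)

lemma Fintype.card_piFinset_ite_le {α β : Type*} [Fintype α] [DecidableEq α] (p : α → Prop)
    [DecidablePred p] (s : α → Finset β) (d : β) {b : ℕ} (h : ∀ a, p a → (s a).card ≤ b) :
    (Fintype.piFinset fun a => if p a then s a else {d}).card ≤
      b ^ (Finset.univ.filter p).card := by
  rw [Fintype.card_piFinset]
  calc ∏ a, (if p a then s a else {d}).card = ∏ a, if p a then (s a).card else 1 :=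
        Finset.prod_congr rfl fun a _ => by split_ifs <;> simp
    _ = ∏ a with p a, (s a).card := (Finset.prod_filter _ _).symm
    _ ≤ _ := Finset.prod_le_pow_card _ _ _ fun a ha => h a (Finset.mem_filter.1 ha).2

/-- A version of a network problem in integer variables with small domains, where the constraints
are sums of small integers. -/
structure IntegerModel {V : Type*} [Fintype V] {n : ℕ} (P : NPO V n) (b : ℕ) where
  dom : Fin n → Finset ℕ
  term : (κ : (u : V) × Fin (P.K u)) → V → (Fin n → ℕ) → ℤ
  bound : ℕ
  dom_card : ∀ j, (dom j).card ≤ b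
  bound_le : 2 * bound + 1 ≤ b
  term_congr : ∀ κ v, P.graph.Adj κ.1 v → ∀ x y, (∀ j ∈ P.X κ.1 ∪ P.X v, x j = y j) →
    term κ v x = term κ v y
  abs_sum_le : ∀ κ, ∀ x ∈ Fintype.piFinset dom, ∀ s : Finset V,
    (∀ v ∈ s, P.graph.Adj κ.1 v) → |∑ v ∈ s, term κ v x| ≤ bound

namespace IntegerModel

variable {V : Type*} [Fintype V] {n : ℕ} {P : NPO V n} {b : ℕ} (I : IntegerModel P b)
  {ι : Type*} [Fintype ι]
  (D : NetworkDecomp P ι)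

open scoped Classical in
/-- The feasible points; the constraints have slack `1`. -/
noncomputable def points : Finset (Fin n → ℕ) :=
  (Fintype.piFinset I.dom).filter fun x => ∀ κ, -1 ≤ ∑ v with P.graph.Adj κ.1 v, I.term κ v x

open scoped Classical in
/-- The part of a constraint located below `i`. -/
noncomputable def partialSum (i : ι) (κ : (u : V) × Fin (P.K u)) (x : Fin n → ℕ) : ℤ :=
  ∑ v with P.graph.Adj κ.1 v ∧ D.Anc i (D.loc κ.1 v), I.term κ v x

/-- What a node shares with its parent: values of variables and partial sums of constraints. -/
abbrev Label (P : NPO V n) := (Fin n → ℕ) × ((u : V) × Fin (P.K u) → ℤ)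

open scoped Classical in
/-- The label of `x` at `i`. -/
noncomputable def label (i : ι) (x : Fin n → ℕ) : Label P :=
  (fun j => if j ∈ D.vars i then x j else 0,
    fun κ => if D.Crosses κ.1 i then I.partialSum D i κ x else 0)

open scoped Classical in
/-- The labels of `x` at `i` and its children. -/
noncomputable def state (i : ι) (x : Fin n → ℕ) : ι → Label P := fun t =>
  if t = i ∨ (t ≠ D.root ∧ D.par t = i) then I.label D t x else (0, 0)

open scoped Classical in
/-- The forest of states that come from feasible points. -/
noncomputable def forest : StateForest ι (ι → Label P) (Label P) where
  par := D.par
  dep := D.dep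
  dep_par i := by
    by_cases h : i = D.root
    · left; rw [h, D.par_root]
    · exact Or.inr (D.dep_par i h)
  states i := I.points.image (I.state D i)
  port i z := z i

omit [Fintype ι] in
lemma state_self (i : ι) (x : Fin n → ℕ) : I.state D i x i = I.label D i x := by
  simp [state]

omit [Fintype ι] in
lemma state_par (i : ι) (x : Fin n → ℕ) : I.state D (D.par i) x i = I.label D i x := by
  by_cases h : i = D.root
  · rw [h, D.par_root, state_self]
  · simp [state, h]

lemma exists_consistent {x : Fin n → ℕ} (hx : x ∈ I.points) :
    ∃ α, (I.forest D).Consistent α ∧ ∀ j, (α (D.varTop j) (D.varTop j)).1 j = x j := by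
  classical
  refine ⟨fun i => I.state D i x, fun i => ⟨Finset.mem_image_of_mem _ hx, ?_⟩, fun j => ?_⟩
  · exact (I.state_self D i x).trans (I.state_par D i x).symm
  · beta_reduce
    rw [state_self]
    exact if_pos (D.vars_subtree j).1

open scoped Classical in
lemma partialSum_eq (i : ι) (κ : (u : V) × Fin (P.K u)) (x : Fin n → ℕ) :
    I.partialSum D i κ x = ∑ v with P.graph.Adj κ.1 v ∧ D.loc κ.1 v = i, I.term κ v x +
      ∑ c with c ≠ D.root ∧ D.par c = i, I.partialSum D c κ x := by
  have h : ∀ q : V → Prop, ∑ v with P.graph.Adj κ.1 v ∧ q v, I.term κ v x =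
      ∑ v with P.graph.Adj κ.1 v, if q v then I.term κ v x else 0 := fun q => by
    rw [← Finset.filter_filter, Finset.sum_filter]
  simp only [partialSum, h]
  rw [Finset.sum_comm, ← Finset.sum_add_distrib]
  exact Finset.sum_congr rfl fun v _ => D.ite_anc_eq i _ _

/-- Induction from the deepest nodes upwards. Terms located at `i` involve only variables of `i`,
where `x` and `X i` agree; for a child crossed by the subtree of the vertex, the labels identify the
partial sums of `X c` and `X i`. -/
lemma partialSum_eq_of_agree (X : ι → Fin n → ℕ) (x : Fin n → ℕ)
    (hvars : ∀ i, ∀ j ∈ D.vars i, X i j = x j)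
    (hlab : ∀ i, I.label D i (X i) = I.label D i (X (D.par i)))
    (κ : (u : V) × Fin (P.K u)) (i : ι) (hi : D.Anc (D.vertTop κ.1) i) :
    I.partialSum D i κ x = I.partialSum D i κ (X i) := by
  classical
  obtain ⟨m, hm⟩ : ∃ m, ∀ i, D.dep i ≤ m :=
    ⟨Finset.univ.sup D.dep, fun i => Finset.le_sup (Finset.mem_univ i)⟩
  induction hk : m - D.dep i using Nat.strong_induction_on generalizing i with
  | _ k ih =>
    rw [partialSum_eq, partialSum_eq]
    congr 1
    · refine Finset.sum_congr rfl fun v hv => ?_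
      obtain ⟨h1, h2⟩ := (Finset.mem_filter.1 hv).2
      refine I.term_congr κ v h1 _ _ fun j hj => (hvars i j ?_).symm
      rw [← h2]
      exact D.loc_vars _ _ h1 hj
    · refine Finset.sum_congr rfl fun c hc => ?_
      obtain ⟨h1, h2⟩ := (Finset.mem_filter.1 hc).2
      have hdep := D.dep_par c h1
      rw [h2] at hdep
      have hc' : D.Anc (D.vertTop κ.1) c := hi.trans (h2 ▸ ParentTree.anc_par c)
      by_cases hcr : D.Crosses κ.1 c
      · have h3 := congrFun (congrArg Prod.snd (hlab c)) κ
        simp only [label, if_pos hcr, h2] at h3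
        rw [← h3]
        refine ih _ ?_ c hc' rfl
        have := hm c
        omega
      -- Below a child that is not crossed no term of the constraint is located, since the subtree
      -- of the vertex would contain that child.
      · have h3 : (Finset.univ.filter fun v => P.graph.Adj κ.1 v ∧ D.Anc c (D.loc κ.1 v)) = ∅ := by
          refine Finset.filter_eq_empty_iff.2 fun v _ hv => hcr ?_
          refine ⟨(D.verts_subtree κ.1).mem_of_anc (D.loc_mem _ _ hv.1) hv.2 hc', fun h => ?_⟩
          rw [← h] at hi
          have := hi.dep_le
          omega
        simp only [partialSum, h3, Finset.sum_empty]

/-- Each state comes from a point `X i` satisfying all constraints. The glued point takes each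
variable from the top of its subtree, and satisfies the constraint `κ` because its sum equals that
of the single point `X (D.vertTop κ.1)`. -/
lemma exists_point {α : ι → ι → Label P} (hα : (I.forest D).Consistent α) :
    ∃ x ∈ I.points, ∀ j, (α (D.varTop j) (D.varTop j)).1 j = x j := by
  classical
  have h1 : ∀ i, ∃ x ∈ I.points, I.state D i x = α i := fun i => Finset.mem_image.1 (hα i).1
  choose X hX hXα using h1
  have hlab : ∀ i, I.label D i (X i) = I.label D i (X (D.par i)) := by
    intro i
    rw [← state_self, ← state_par, hXα, hXα]
    exact (hα i).2
  let x : Fin n → ℕ := fun j => X (D.varTop j) j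
  have hvars : ∀ i, ∀ j ∈ D.vars i, X i j = x j := by
    intro i j hj
    induction hk : D.dep i using Nat.strong_induction_on generalizing i with
    | _ k ih =>
      by_cases hi : i = D.varTop j
      · rw [hi]
      · obtain ⟨h2, h3⟩ := (D.vars_subtree j).2 i hj hi
        have h4 := congrFun (congrArg Prod.fst (hlab i)) j
        simp only [label, if_pos hj] at h4
        rw [h4]
        exact ih _ (hk ▸ D.dep_par i h2) _ h3 rfl
  have hsum : ∀ κ y, I.partialSum D (D.vertTop κ.1) κ y =
      ∑ v with P.graph.Adj κ.1 v, I.term κ v y := by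
    intro κ y
    refine Finset.sum_congr (Finset.filter_congr fun v _ => and_iff_left_of_imp fun h => ?_)
      fun _ _ => rfl
    exact (D.verts_subtree κ.1).anc (D.loc_mem _ _ h)
  refine ⟨x, Finset.mem_filter.2 ⟨Fintype.mem_piFinset.2 fun j => ?_, fun κ => ?_⟩, fun j => ?_⟩
  · exact Fintype.mem_piFinset.1 (Finset.mem_filter.1 (hX (D.varTop j))).1 j
  · rw [← hsum, I.partialSum_eq_of_agree D X x hvars hlab κ _ (ParentTree.Anc.refl _), hsum]
    exact (Finset.mem_filter.1 (hX _)).2 κ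
  · rw [← hXα, state_self]
    exact if_pos (D.vars_subtree j).1

open scoped Classical in
/-- The set of all conceivable labels at `i`. -/
noncomputable def labels (i : ι) : Finset (Label P) :=
  (Fintype.piFinset fun j => if j ∈ D.vars i then I.dom j else {0}) ×ˢ
    Fintype.piFinset fun κ : (u : V) × Fin (P.K u) =>
      if D.Crosses κ.1 i then Finset.Icc (-(I.bound : ℤ)) I.bound else {0}

omit [Fintype ι] in
lemma label_mem {x : Fin n → ℕ} (hx : x ∈ I.points) (i : ι) : I.label D i x ∈ I.labels D i := by
  classical
  have hx' := (Finset.mem_filter.1 hx).1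
  refine Finset.mem_product.2 ⟨Fintype.mem_piFinset.2 fun j => ?_,
    Fintype.mem_piFinset.2 fun κ => ?_⟩
  · simp only [label]
    split_ifs
    · exact Fintype.mem_piFinset.1 hx' j
    · exact Finset.mem_singleton_self _
  · simp only [label]
    split_ifs
    · exact Finset.mem_Icc.2 (abs_le.1 (I.abs_sum_le κ x hx' _ fun v hv =>
        (Finset.mem_filter.1 hv).2.1))
    · exact Finset.mem_singleton_self _

omit [Fintype ι] in
lemma card_labels_le (i : ι) : (I.labels D i).card ≤ b ^ D.weight i := by
  classical
  rw [labels, Finset.card_product, NetworkDecomp.weight, pow_add]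
  refine Nat.mul_le_mul ?_ ?_
  · refine (Fintype.card_piFinset_ite_le _ _ _ fun j _ => I.dom_card j).trans_eq ?_
    congr 2
    ext; simp
  · refine (Fintype.card_piFinset_ite_le _ _ _ fun κ _ => (?_ : _ ≤ b)).trans_eq ?_
    · rw [Int.card_Icc]
      have := I.bound_le
      omega
    · congr 1
      have : (Finset.univ.filter fun κ : (u : V) × Fin (P.K u) => D.Crosses κ.1 i) =
          (Finset.univ.filter fun u => D.Crosses u i).sigma fun u => Finset.univ := by
        ext; simp
      rw [this, Finset.card_sigma]
      simp

/-- A state is made of at most three labels, of the node and of its at most two children; this is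
the 3 in the exponent. -/
lemma card_states_le (hD : D.IsBinary) {w : ℕ} (hw : ∀ i, D.weight i ≤ w) (i : ι) :
    ((I.forest D).states i).card ≤ b ^ (3 * w) := by
  classical
  have hb : 1 ≤ b := le_trans (by omega) I.bound_le
  have hsub : (I.forest D).states i ⊆ Fintype.piFinset fun t =>
      if t = i ∨ (t ≠ D.root ∧ D.par t = i) then I.labels D t else {(0, 0)} := by
    intro z hz
    obtain ⟨x, hx, rfl⟩ := Finset.mem_image.1 hz
    refine Fintype.mem_piFinset.2 fun t => ?_
    simp only [state]
    split_ifs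
    · exact I.label_mem D hx t
    · exact Finset.mem_singleton_self _
  refine (Finset.card_le_card hsub).trans ((Fintype.card_piFinset_ite_le _ _ _ fun t _ =>
    (I.card_labels_le D t).trans (Nat.pow_le_pow_right hb (hw t))).trans ?_)
  rw [← pow_mul, mul_comm]
  refine Nat.pow_le_pow_right hb (Nat.mul_le_mul_right _ ?_)
  obtain ⟨side, hside⟩ := hD
  rw [Finset.filter_or]
  refine (Finset.card_union_le _ _).trans ?_
  have h1 : (Finset.univ.filter fun t => t = i).card ≤ 1 := Finset.card_le_one.2 fun a ha a' ha' => by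
    rw [(Finset.mem_filter.1 ha).2, (Finset.mem_filter.1 ha').2]
  have h2 : (Finset.univ.filter fun t => t ≠ D.root ∧ D.par t = i).card ≤ 2 := by
    refine (Finset.card_le_card_of_injOn (t := Finset.univ) side
      (fun _ _ => Finset.mem_coe.2 (Finset.mem_univ _)) ?_).trans (by simp)
    intro c hc c' hc' h
    simp only [Finset.coe_filter, Finset.mem_univ, true_and, Set.mem_ofPred_eq] at hc hc'
    exact hside c c' hc.1 hc'.1 (hc.2.trans hc'.2.symm) h
  omega

end IntegerModel

/-! ### Lipschitz estimates for polynomials on the cube -/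

/-- Factors are exchanged one at a time; those left in place have absolute value at most 1. -/
lemma Finset.abs_prod_sub_prod_le {α : Type*} (s : Finset α) (a b e : α → ℝ)
    (ha : ∀ i, 0 ≤ a i ∧ a i ≤ 1) (hb : ∀ i, 0 ≤ b i ∧ b i ≤ 1) (he : ∀ i, |a i - b i| ≤ e i) :
    |∏ i ∈ s, a i - ∏ i ∈ s, b i| ≤ ∑ i ∈ s, e i := by
  classical
  induction s using Finset.induction_on with
  | empty => simp
  | insert i s hi ih =>
    rw [Finset.prod_insert hi, Finset.prod_insert hi, Finset.sum_insert hi]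
    have h1 : 0 ≤ ∏ i ∈ s, a i := Finset.prod_nonneg fun i _ => (ha i).1
    have h2 : ∏ i ∈ s, a i ≤ 1 := Finset.prod_le_one (fun i _ => (ha i).1) fun i _ => (ha i).2
    calc |a i * ∏ i ∈ s, a i - b i * ∏ i ∈ s, b i|
        = |(a i - b i) * ∏ i ∈ s, a i + b i * (∏ i ∈ s, a i - ∏ i ∈ s, b i)| := by ring_nf
      _ ≤ |a i - b i| * |∏ i ∈ s, a i| + |b i| * |∏ i ∈ s, a i - ∏ i ∈ s, b i| := by
        rw [← abs_mul, ← abs_mul]; exact abs_add_le _ _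
      _ ≤ e i * 1 + 1 * ∑ i ∈ s, e i := by
        gcongr
        · exact (abs_nonneg _).trans (he i)
        · exact he i
        · rwa [abs_of_nonneg h1]
        · rw [abs_of_nonneg (hb i).1]; exact (hb i).2
      _ = _ := by ring

lemma abs_pow_sub_pow_le_mul {x y δ : ℝ} (hx : 0 ≤ x ∧ x ≤ 1) (hy : 0 ≤ y ∧ y ≤ 1)
    (h : |x - y| ≤ δ) (k : ℕ) : |x ^ k - y ^ k| ≤ k * δ := by
  simpa using (Finset.range k).abs_prod_sub_prod_le (fun _ => x) (fun _ => y) (fun _ => δ)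
    (fun _ => hx) (fun _ => hy) fun _ => h

namespace MvPolynomial

variable {n : ℕ}

lemma abs_monomial_le_one {x : Fin n → ℝ} (hx : ∀ j, 0 ≤ x j ∧ x j ≤ 1) (d : Fin n →₀ ℕ) :
    |∏ i, x i ^ d i| ≤ 1 := by
  rw [abs_of_nonneg (Finset.prod_nonneg fun i _ => pow_nonneg (hx i).1 _)]
  exact Finset.prod_le_one (fun i _ => pow_nonneg (hx i).1 _)
    fun i _ => pow_le_one₀ (hx i).1 (hx i).2

lemma abs_eval_le (f : MvPolynomial (Fin n) ℝ) {x : Fin n → ℝ} (hx : ∀ j, 0 ≤ x j ∧ x j ≤ 1) :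
    |eval x f| ≤ polyL1Norm f := by
  rw [eval_eq']
  refine (Finset.abs_sum_le_sum_abs _ _).trans (Finset.sum_le_sum fun d _ => ?_)
  rw [abs_mul]
  exact mul_le_of_le_one_right (abs_nonneg _) (abs_monomial_le_one hx d)

lemma abs_eval_sub_eval_le (f : MvPolynomial (Fin n) ℝ) {x y : Fin n → ℝ} {δ : ℝ} {p : ℕ}
    (hx : ∀ j, 0 ≤ x j ∧ x j ≤ 1) (hy : ∀ j, 0 ≤ y j ∧ y j ≤ 1) (h : ∀ j, |x j - y j| ≤ δ)
    (hδ : 0 ≤ δ) (hf : f.totalDegree ≤ p) :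
    |eval x f - eval y f| ≤ p * δ * polyL1Norm f := by
  rw [eval_eq', eval_eq', ← Finset.sum_sub_distrib, polyL1Norm, Finset.mul_sum]
  refine (Finset.abs_sum_le_sum_abs _ _).trans (Finset.sum_le_sum fun d hd => ?_)
  rw [← mul_sub, abs_mul, mul_comm]
  refine mul_le_mul_of_nonneg_right ?_ (abs_nonneg _)
  refine (Finset.abs_prod_sub_prod_le _ _ _ (fun i => d i * δ)
    (fun i => ⟨pow_nonneg (hx i).1 _, pow_le_one₀ (hx i).1 (hx i).2⟩)
    (fun i => ⟨pow_nonneg (hy i).1 _, pow_le_one₀ (hy i).1 (hy i).2⟩)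
    fun i => abs_pow_sub_pow_le_mul (hx i) (hy i) (h i) _).trans ?_
  rw [← Finset.sum_mul]
  refine mul_le_mul_of_nonneg_right ?_ hδ
  have := (le_totalDegree hd).trans hf
  rw [Finsupp.sum_fintype _ _ fun _ => rfl] at this
  exact_mod_cast this

end MvPolynomial

/-! ### Rounding to an integer model -/

namespace NPO

variable {V : Type*} [Fintype V] {n : ℕ} (P : NPO V n)

/-- Summation may cancel monomials but creates none. Distributing the surviving monomials of the
constraint among the neighbours, instead of using the given `poly u v k`, keeps the absolute values
of the parts within ‖f‖₁ in total. -/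
lemma exists_poly_of_mem_support (u : V) (k : Fin (P.K u)) (m : Fin n →₀ ℕ) :
    ∃ v, m ∈ (P.lhs u k).support → P.graph.Adj u v ∧ m ∈ (P.poly u v k).support := by
  classical
  by_cases h : m ∈ (P.lhs u k).support
  · rw [MvPolynomial.mem_support_iff, lhs, MvPolynomial.coeff_sum] at h
    obtain ⟨v, hv, hne⟩ := Finset.exists_ne_zero_of_sum_ne_zero h
    exact ⟨v, fun _ => ⟨(Finset.mem_filter.1 hv).2, MvPolynomial.mem_support_iff.2 hne⟩⟩
  · exact ⟨u, fun h' => absurd h' h⟩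

/-- A neighbour `v` of `u` such that the monomial `m` of a constraint of `u` involves only variables
of `u` and `v`. -/
noncomputable def assign (u : V) (k : Fin (P.K u)) (m : Fin n →₀ ℕ) : V :=
  (P.exists_poly_of_mem_support u k m).choose

lemma assign_spec {u : V} {k : Fin (P.K u)} {m : Fin n →₀ ℕ} (h : m ∈ (P.lhs u k).support) :
    P.graph.Adj u (P.assign u k m) ∧ m ∈ (P.poly u (P.assign u k m) k).support :=
  (P.exists_poly_of_mem_support u k m).choose_spec h

lemma totalDegree_lhs_le {p : ℕ}
    (hp : ∀ u v k, P.graph.Adj u v → (P.poly u v k).totalDegree ≤ p) (u : V) (k : Fin (P.K u)) :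
    (P.lhs u k).totalDegree ≤ p :=
  Finset.sup_le fun _ hm => (MvPolynomial.le_totalDegree (P.assign_spec hm).2).trans
    (hp _ _ _ (P.assign_spec hm).1)

open scoped Classical in
/-- The value at `x` of the monomials of a constraint of `u` that are assigned to `v`. -/
noncomputable def part (u : V) (k : Fin (P.K u)) (v : V) (x : Fin n → ℝ) : ℝ :=
  ∑ m ∈ (P.lhs u k).support with P.assign u k m = v, (P.lhs u k).coeff m * ∏ i, x i ^ m i

open scoped Classical in
lemma sum_part (u : V) (k : Fin (P.K u)) (x : Fin n → ℝ) :
    ∑ v with P.graph.Adj u v, P.part u k v x = MvPolynomial.eval x (P.lhs u k) := by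
  rw [MvPolynomial.eval_eq']
  exact Finset.sum_fiberwise_of_maps_to
    (fun m hm => Finset.mem_filter.2 ⟨Finset.mem_univ _, (P.assign_spec hm).1⟩) _

lemma sum_abs_part_le (u : V) (k : Fin (P.K u)) (s : Finset V) {x : Fin n → ℝ}
    (hx : ∀ j, 0 ≤ x j ∧ x j ≤ 1) : ∑ v ∈ s, |P.part u k v x| ≤ polyL1Norm (P.lhs u k) := by
  classical
  calc ∑ v ∈ s, |P.part u k v x|
      ≤ ∑ v, |P.part u k v x| :=
        Finset.sum_le_sum_of_subset_of_nonneg (Finset.subset_univ _) fun _ _ _ => abs_nonneg _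
    _ ≤ ∑ v, ∑ m ∈ (P.lhs u k).support with P.assign u k m = v, |(P.lhs u k).coeff m| := by
        refine Finset.sum_le_sum fun v _ => (Finset.abs_sum_le_sum_abs _ _).trans
          (Finset.sum_le_sum fun m _ => ?_)
        rw [abs_mul]
        exact mul_le_of_le_one_right (abs_nonneg _) (MvPolynomial.abs_monomial_le_one hx m)
    _ = _ := Finset.sum_fiberwise _ _ _

lemma part_congr {u v : V} (k : Fin (P.K u)) {x y : Fin n → ℝ}
    (h : ∀ j ∈ P.X u ∪ P.X v, x j = y j) : P.part u k v x = P.part u k v y := by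
  classical
  refine Finset.sum_congr rfl fun m hm => ?_
  obtain ⟨hm', rfl⟩ := Finset.mem_filter.1 hm
  congr 1
  refine Finset.prod_congr rfl fun i _ => ?_
  by_cases hi : m i = 0
  · simp [hi]
  · rw [h i (P.poly_vars _ _ _ (P.assign_spec hm').1 ((MvPolynomial.mem_vars_iff_mem_support _).2
      ⟨m, (P.assign_spec hm').2, Finsupp.mem_support_iff.2 hi⟩))]

/-- The point of the grid with mesh `1 / N` given by integer coordinates. -/
noncomputable def gridPoint (N : ℕ) (x : Fin n → ℕ) : Fin n → ℝ := fun j => x j / N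

open scoped Classical in
/-- The coordinates of the grid points that satisfy the bound and integrality conditions. -/
noncomputable def gridDom (N : ℕ) (j : Fin n) : Finset ℕ :=
  if j ∈ P.binary then {0, N} else Finset.range (N + 1)

omit [Fintype V] in
lemma le_of_mem_gridDom {N a : ℕ} {j : Fin n} (h : a ∈ P.gridDom N j) : a ≤ N := by
  unfold gridDom at h
  split_ifs at h
  · simp only [Finset.mem_insert, Finset.mem_singleton] at h
    omega
  · exact Nat.lt_succ_iff.1 (Finset.mem_range.1 h)

omit [Fintype V] in
lemma inBox_gridPoint {N : ℕ} (hN : 1 ≤ N) {x : Fin n → ℕ} (hx : ∀ j, x j ∈ P.gridDom N j) :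
    P.InBox (gridPoint N x) := by
  have hN' : (0 : ℝ) < N := by exact_mod_cast hN
  refine fun j => ⟨⟨by unfold gridPoint; positivity, ?_⟩, fun hj => ?_⟩
  · rw [gridPoint, div_le_one hN']
    exact_mod_cast P.le_of_mem_gridDom (hx j)
  · have := hx j
    rw [gridDom, if_pos hj, Finset.mem_insert, Finset.mem_singleton] at this
    rcases this with h | h
    · left; simp [gridPoint, h]
    · right; simp [gridPoint, h, hN'.ne']

/-- The term of the neighbour `v` in a constraint of `u`, scaled and rounded. -/
noncomputable def roundedPart (N H : ℕ) (κ : (u : V) × Fin (P.K u)) (v : V) (x : Fin n → ℕ) : ℤ :=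
  ⌈H * P.part κ.1 κ.2 v (gridPoint N x) / polyL1Norm (P.lhs κ.1 κ.2)⌉

lemma polyL1Norm_nonneg (f : MvPolynomial (Fin n) ℝ) : 0 ≤ polyL1Norm f :=
  Finset.sum_nonneg fun _ _ => abs_nonneg _

/-- The scaled parts have total absolute value at most `H`, and each of at most `d` ceilings adds at
most 1; then `d ≤ H`. -/
lemma abs_sum_roundedPart_le {N H d : ℕ} (hN : 1 ≤ N) (hd : d ≤ H)
    (hdeg : ∀ u, (P.graph.neighborSet u).ncard ≤ d) (κ : (u : V) × Fin (P.K u)) {x : Fin n → ℕ}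
    (hx : ∀ j, x j ∈ P.gridDom N j) (s : Finset V) (hs : ∀ v ∈ s, P.graph.Adj κ.1 v) :
    |∑ v ∈ s, P.roundedPart N H κ v x| ≤ (2 * H : ℕ) := by
  set L := polyL1Norm (P.lhs κ.1 κ.2)
  have hL : 0 ≤ L := polyL1Norm_nonneg _
  have hcard : s.card ≤ d := by
    refine le_trans ?_ (hdeg κ.1)
    rw [← Set.ncard_coe_finset]
    exact Set.ncard_le_ncard (fun v hv => hs v hv) (Set.toFinite _)
  have h1 : ∀ v, |(P.roundedPart N H κ v x : ℝ)| ≤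
      H * |P.part κ.1 κ.2 v (gridPoint N x)| / L + 1 := by
    intro v
    set y := H * P.part κ.1 κ.2 v (gridPoint N x) / L with hy
    have h2 : H * |P.part κ.1 κ.2 v (gridPoint N x)| / L = |y| := by
      rw [hy, abs_div, abs_mul, abs_of_nonneg hL, Nat.abs_cast]
    rw [h2]
    have h3 := Int.le_ceil y
    have h4 := (Int.ceil_lt_add_one y).le
    have h5 := neg_abs_le y
    have h6 := le_abs_self y
    exact abs_le.2 ⟨by unfold roundedPart; linarith, by unfold roundedPart; linarith⟩
  have h2 : |(∑ v ∈ s, P.roundedPart N H κ v x : ℝ)| ≤ H + d := by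
    refine (Finset.abs_sum_le_sum_abs _ _).trans ((Finset.sum_le_sum fun v _ => h1 v).trans ?_)
    rw [Finset.sum_add_distrib, ← Finset.sum_div, ← Finset.mul_sum]
    refine add_le_add ?_ (by simpa using hcard)
    have h3 := P.sum_abs_part_le κ.1 κ.2 s fun j => (P.inBox_gridPoint hN hx j).1
    rw [mul_div_assoc]
    exact mul_le_of_le_one_right (by positivity) (div_le_one_of_le₀ h3 hL)
  have h3 : (H + d : ℝ) ≤ 2 * H := by
    have : (d : ℝ) ≤ H := by exact_mod_cast hd
    linarith
  have h4 := h2.trans h3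
  exact_mod_cast h4

/-- The integer model of a network problem, on a grid of mesh `1 / N`. -/
noncomputable def integerModel {N H d : ℕ} (hN : 1 ≤ N) (hH : H ≤ N) (hd : d ≤ H)
    (hdeg : ∀ u, (P.graph.neighborSet u).ncard ≤ d) : IntegerModel P (4 * N + 1) where
  dom := P.gridDom N
  term := P.roundedPart N H
  bound := 2 * H
  dom_card j := by
    have : P.gridDom N j ⊆ Finset.range (N + 1) := fun a ha =>
      Finset.mem_range.2 (Nat.lt_succ_of_le (P.le_of_mem_gridDom ha))
    exact (Finset.card_le_card this).trans (by rw [Finset.card_range]; omega)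
  bound_le := by omega
  term_congr κ v _ x y h := by
    unfold roundedPart
    rw [P.part_congr κ.2 fun j hj => ?_]
    rw [gridPoint, gridPoint, h j hj]
  abs_sum_le κ x hx s hs :=
    P.abs_sum_roundedPart_le hN hd hdeg κ (Fintype.mem_piFinset.1 hx) s hs

variable {N H d : ℕ} (hN : 1 ≤ N) (hH : H ≤ N) (hd : d ≤ H)
  (hdeg : ∀ u, (P.graph.neighborSet u).ncard ≤ d)

/-- The feasible points of the integer model are scaled-`ε` feasible. -/
lemma scaledFeasible_gridPoint {ε : ℝ} (hε : 1 + d ≤ ε * H) {x : Fin n → ℕ}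
    (hx : x ∈ (P.integerModel hN hH hd hdeg).points) : P.ScaledFeasible ε (gridPoint N x) := by
  classical
  obtain ⟨h1, h2⟩ := Finset.mem_filter.1 hx
  have hbox := P.inBox_gridPoint hN (Fintype.mem_piFinset.1 h1)
  refine ⟨hbox, fun u k => ?_⟩
  set L := polyL1Norm (P.lhs u k) with hL
  -- A constraint of norm 0 vanishes on the cube and is treated apart from the division by the norm.
  rcases (polyL1Norm_nonneg (P.lhs u k)).eq_or_lt with h0 | h0
  · have := MvPolynomial.abs_eval_le (P.lhs u k) fun j => (hbox j).1
    rw [← h0] at this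
    rw [abs_nonpos_iff.1 this, hL, ← h0]
    simp
  · rw [← hL] at h0
    have h3 : (-1 : ℝ) ≤ ∑ v with P.graph.Adj u v, (P.roundedPart N H ⟨u, k⟩ v x : ℝ) := by
      exact_mod_cast h2 ⟨u, k⟩
    have h4 : ∑ v with P.graph.Adj u v, (P.roundedPart N H ⟨u, k⟩ v x : ℝ) ≤
        H * MvPolynomial.eval (gridPoint N x) (P.lhs u k) / L + d := by
      rw [← P.sum_part, Finset.mul_sum, Finset.sum_div]
      have h5 : ((Finset.univ.filter fun v => P.graph.Adj u v).card : ℝ) ≤ d := by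
        refine le_trans (le_of_eq ?_) (Nat.cast_le.2 (hdeg u))
        rw [← Set.ncard_coe_finset]
        congr 2
        ext; simp
      refine le_trans ?_ (add_le_add_right h5 _)
      rw [Finset.card_eq_sum_ones, Nat.cast_sum, ← Finset.sum_add_distrib]
      refine Finset.sum_le_sum fun v _ => ?_
      rw [Nat.cast_one]
      exact (Int.ceil_lt_add_one _).le
    have h5 : -(ε * H) ≤ H * MvPolynomial.eval (gridPoint N x) (P.lhs u k) / L := by linarith
    rw [le_div_iff₀ h0] at h5
    have hH0 : (0 : ℝ) < H := by
      rcases Nat.eq_zero_or_pos H with h | h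
      · rw [h] at hε
        have : (0 : ℝ) ≤ d := Nat.cast_nonneg _
        norm_num at hε
        linarith
      · exact_mod_cast h
    refine le_of_mul_le_mul_left ?_ hH0
    linarith

/-- Rounding down a feasible point gives a feasible point of the integer model. -/
lemma exists_mem_points {p : ℕ} (hp : ∀ u v k, P.graph.Adj u v → (P.poly u v k).totalDegree ≤ p)
    (hNH : N = H * p) {x : Fin n → ℝ} (hx : P.Feasible x) :
    ∃ x' ∈ (P.integerModel hN hH hd hdeg).points, ∀ j, |gridPoint N x' j - x j| ≤ 1 / N := by
  classical
  have hN0 : (0 : ℝ) < N := by exact_mod_cast hN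
  -- Rounding down fixes the values 0 and 1, so binary coordinates stay binary.
  let x' : Fin n → ℕ := fun j => ⌊N * x j⌋₊
  have hdom : ∀ j, x' j ∈ P.gridDom N j := by
    intro j
    unfold gridDom
    split_ifs with hj
    · rcases (hx.1 j).2 hj with h | h <;> simp [x', h]
    · refine Finset.mem_range.2 (Nat.lt_succ_of_le (Nat.floor_le_of_le ?_))
      exact mul_le_of_le_one_right hN0.le (hx.1 j).1.2
  have hclose : ∀ j, |gridPoint N x' j - x j| ≤ 1 / N := by
    intro j
    have h1 := Nat.floor_le (mul_nonneg hN0.le (hx.1 j).1.1)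
    have h2 := Nat.lt_floor_add_one (N * x j)
    have h3 : gridPoint N x' j - x j = (x' j - N * x j) / N := by
      simp only [gridPoint]
      field_simp
    rw [h3, abs_div, abs_of_pos hN0]
    gcongr
    exact abs_le.2 ⟨by simp only [x']; linarith, by simp only [x']; linarith⟩
  refine ⟨x', Finset.mem_filter.2 ⟨Fintype.mem_piFinset.2 hdom, ?_⟩, hclose⟩
  rintro ⟨u, k⟩
  set L := polyL1Norm (P.lhs u k) with hL
  have h1 : H * MvPolynomial.eval (gridPoint N x') (P.lhs u k) / L ≤
      ∑ v with P.graph.Adj u v, (P.roundedPart N H ⟨u, k⟩ v x' : ℝ) := by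
    rw [← P.sum_part, Finset.mul_sum, Finset.sum_div]
    exact Finset.sum_le_sum fun v _ => Int.le_ceil _
  have h2 : -1 ≤ H * MvPolynomial.eval (gridPoint N x') (P.lhs u k) / L := by
    rcases (polyL1Norm_nonneg (P.lhs u k)).eq_or_lt with h0 | h0
    · rw [hL, ← h0]; norm_num
    · rw [← hL] at h0
      rw [le_div_iff₀ h0]
      have h3 := MvPolynomial.abs_eval_sub_eval_le (P.lhs u k)
        (fun j => (P.inBox_gridPoint hN hdom j).1) (fun j => (hx.1 j).1) hclose (by positivity)
        (P.totalDegree_lhs_le hp u k)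
      have h4 := (abs_le.1 h3).1
      have h5 := hx.2 u k
      -- The choice N = Hp makes the scaled rounding error at most 1, which is exactly the slack in
      -- `IntegerModel.points`.
      have h6 : (H : ℝ) * (p * (1 / N) * L) = L := by
        have : (N : ℝ) = H * p := by exact_mod_cast hNH
        rw [this] at hN0 ⊢
        have hH0 : (H : ℝ) ≠ 0 := left_ne_zero_of_mul hN0.ne'
        have hp0 : (p : ℝ) ≠ 0 := right_ne_zero_of_mul hN0.ne'
        field_simp
      have h7 : (H : ℝ) * -(p * (1 / N) * L) ≤
          H * MvPolynomial.eval (gridPoint N x') (P.lhs u k) :=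
        mul_le_mul_of_nonneg_left (by linarith) (Nat.cast_nonneg _)
      linarith
  have h3 := h2.trans h1
  exact_mod_cast h3

end NPO

/-! ### Assembly and constants -/

namespace NPO

variable {V : Type*} [Fintype V] {n : ℕ} (P : NPO V n)

/-- If only the bound and integrality conditions matter, then a linear program over the cube solves
the problem. -/
lemma exists_linProg_of_inBox {ε : ℝ} (hε : 0 ≤ ε) (h : ∀ x, P.InBox x → P.ScaledFeasible ε x) :
    ∃ (s r : ℕ) (A : Matrix (Fin r) (Fin s) ℝ) (b : Fin r → ℝ) (M : Matrix (Fin n) (Fin s) ℝ),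
      s + r ≤ 16 * n ∧
      (∀ i k, A i k ∈ ({-1, 0, 1} : Set ℝ)) ∧
      (∀ i, b i ∈ ({-1, 0, 1} : Set ℝ)) ∧
      (∀ j k, ∃ a : ℕ, a ≤ 1 ∧ M j k = a / (1 : ℕ)) ∧
      ∀ c : Fin n → ℝ, SolvesWithin ⟨A, b, Matrix.vecMul c M⟩ M P c ε := by
  -- One isolated node per variable, with the states 0 and 1: a linear objective on the cube is
  -- minimised at a vertex, and vertices meet every integrality condition.
  let F : StateForest (Fin n) Bool Unit :=
    ⟨id, fun _ => 0, fun _ => Or.inl rfl, fun _ => Finset.univ, fun _ _ => ()⟩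
  have hF : ∀ α, F.Consistent α := fun α i => ⟨Finset.mem_univ _, rfl⟩
  have := F.exists_linProg P ε (q := 2) (N := 1) one_le_two (fun i => by simp [F]) id
    (fun _ z => if z then 1 else 0) (fun j z _ => by split_ifs <;> simp)
    (fun α _ => h _ fun j => by cases h : α j <;> simp [h])
    (fun c x hx => ⟨fun j => decide (c j < 0), hF _, by
      refine le_trans (Finset.sum_le_sum fun j _ => ?_)
        (le_add_of_nonneg_right (mul_nonneg hε (Finset.sum_nonneg fun j _ => abs_nonneg (c j))))
      obtain ⟨h0, h1⟩ := (hx.1 j).1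
      by_cases hc : c j < 0
      · simp only [id, hc, decide_true, if_true, Nat.cast_one, div_one, mul_one]
        nlinarith
      · simp only [id, hc, decide_false, Bool.false_eq_true, if_false, Nat.cast_zero, zero_div,
          mul_zero]
        exact mul_nonneg (not_lt.1 hc) h0⟩)
  obtain ⟨s, r, A, b, M, hsr, hrest⟩ := this
  refine ⟨s, r, A, b, M, hsr.trans ?_, hrest⟩
  rw [Fintype.card_fin]
  omega

/-- The exponent has a factor 2 from the passage to a binary tree and a factor 3 from the labels in
a state; 2n + 1 bounds the nodes after contraction. -/
lemma exists_linProg_of_treeWidthLE {ω d p Δ N H : ℕ} {ε : ℝ} (hω : TreeWidthLE P.graph ω)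
    (hdeg : ∀ u, (P.graph.neighborSet u).ncard ≤ d)
    (hp : ∀ u v k, P.graph.Adj u v → (P.poly u v k).totalDegree ≤ p)
    (hΔ : ∀ u, (P.X u).card + P.K u ≤ Δ) (hΔ1 : 1 ≤ Δ) (hN : 1 ≤ N) (hH : H ≤ N) (hd : d ≤ H)
    (hNH : N = H * p) (hε : 0 < ε) (hεH : 1 + d ≤ ε * H) :
    ∃ (s r : ℕ) (A : Matrix (Fin r) (Fin s) ℝ) (b : Fin r → ℝ) (M : Matrix (Fin n) (Fin s) ℝ),
      s + r ≤ 8 * (2 * n + 1) * (4 * N + 1) ^ (6 * ((ω + 1) * Δ)) ∧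
      (∀ i k, A i k ∈ ({-1, 0, 1} : Set ℝ)) ∧
      (∀ i, b i ∈ ({-1, 0, 1} : Set ℝ)) ∧
      (∀ j k, ∃ a : ℕ, a ≤ N ∧ M j k = a / N) ∧
      ∀ c : Fin n → ℝ, SolvesWithin ⟨A, b, Matrix.vecMul c M⟩ M P c ε := by
  classical
  obtain ⟨ι₀, _, D₀, hD₀⟩ := P.exists_networkDecomp hω hΔ hΔ1
  obtain ⟨D₁, hbin₁, hD₁⟩ := D₀.exists_binary hD₀
  obtain ⟨ι, _, D, hbin, hD, hcard⟩ := NetworkDecomp.exists_card_le _ rfl D₁ hbin₁ hD₁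
  let I := P.integerModel hN hH hd hdeg
  have hN0 : (0 : ℝ) < N := by exact_mod_cast hN
  have h1N : (1 : ℝ) / N ≤ ε := by
    rw [div_le_iff₀ hN0]
    have h1 : (H : ℝ) ≤ N := by exact_mod_cast hH
    have h2 : (0 : ℝ) ≤ d := Nat.cast_nonneg _
    nlinarith
  have := (I.forest D).exists_linProg P ε (q := (4 * N + 1) ^ (3 * (2 * ((ω + 1) * Δ)))) (N := N)
    (Nat.one_le_pow _ _ (by omega)) (I.card_states_le D hbin hD) D.varTop
    (fun j z => (z (D.varTop j)).1 j)
    (fun j z hz => by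
      obtain ⟨x, hx, rfl⟩ := Finset.mem_image.1 hz
      rw [I.state_self, IntegerModel.label]
      dsimp only
      split_ifs
      · exact P.le_of_mem_gridDom (Fintype.mem_piFinset.1 (Finset.mem_filter.1 hx).1 j)
      · exact Nat.zero_le _)
    (fun α hα => by
      obtain ⟨x, hx, hxα⟩ := I.exists_point D hα
      have := P.scaledFeasible_gridPoint hN hH hd hdeg hεH hx
      simp only [hxα]
      exact this)
    (fun c x hx => by
      obtain ⟨x', hx', hclose⟩ := P.exists_mem_points hN hH hd hdeg hp hNH hx
      obtain ⟨α, hα, hval⟩ := I.exists_consistent D hx'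
      refine ⟨α, hα, ?_⟩
      simp only [hval]
      rw [← sub_le_iff_le_add', ← dotProduct_sub, Finset.mul_sum]
      refine Finset.sum_le_sum fun j _ => (le_abs_self _).trans ?_
      rw [abs_mul, mul_comm]
      exact mul_le_mul_of_nonneg_right ((hclose j).trans h1N) (abs_nonneg _))
  obtain ⟨s, r, A, b, M, hsr, hrest⟩ := this
  refine ⟨s, r, A, b, M, hsr.trans ?_, hrest⟩
  rw [show 6 * ((ω + 1) * Δ) = 3 * (2 * ((ω + 1) * Δ)) by ring]
  gcongr

end NPO

/-- A graph of tree-width `0` has no edges. -/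
lemma TreeWidthLE.not_adj {V : Type*} {G : SimpleGraph V} (h : TreeWidthLE G 0) (u v : V) :
    ¬ G.Adj u v := by
  obtain ⟨T, hT⟩ := h
  intro huv
  obtain ⟨t, hu, hv⟩ := T.edge u v huv
  exact huv.ne (Finset.card_le_one.1 (hT t) u hu v hv)

theorem theorem1p2 :
    ∃ C : ℕ, ∀ (V : Type*) [Fintype V] (n ω D π Δ : ℕ) (P : NPO V n) (ε : ℝ),
      1 ≤ n → 1 ≤ D → 1 ≤ π →
      TreeWidthLE P.graph ω →
      (∀ u, (P.graph.neighborSet u).ncard ≤ D) →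
      (∀ u v k, P.graph.Adj u v → (P.poly u v k).totalDegree ≤ π) →
      (∀ u, (P.X u).card + P.K u ≤ Δ) →
      0 < ε → ε < 1 →
      -- The constraints `A y ≥ b` and the map `M` do not depend on the objective `c`.
      ∃ (s r : ℕ) (A : Matrix (Fin r) (Fin s) ℝ) (b : Fin r → ℝ)
        (M : Matrix (Fin n) (Fin s) ℝ) (N : ℕ),
        ((s + r : ℕ) : ℝ) ≤
          C * (2 * D * π / ε) ^ (C * Δ * ω) * n * Real.log (2 * π / ε) ∧
        (∀ i k, A i k ∈ ({-1, 0, 1} : Set ℝ)) ∧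
        (∀ i, b i ∈ ({-1, 0, 1} : Set ℝ)) ∧
        1 ≤ N ∧ (N : ℝ) ≤ C * (D * π / ε) ∧
        (∀ j k, ∃ a : ℕ, a ≤ N ∧ M j k = a / N) ∧
        ∀ c : Fin n → ℝ, SolvesWithin ⟨A, b, Matrix.vecMul c M⟩ M P c ε := by
  refine ⟨48, fun V _ n ω D π Δ P ε hn hD hπ hω hdeg hp hΔ hε hε1 => ?_⟩
  have hD' : (1 : ℝ) ≤ D := by exact_mod_cast hD
  have hπ' : (1 : ℝ) ≤ π := by exact_mod_cast hπ
  have hn' : (1 : ℝ) ≤ n := by exact_mod_cast hn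
  have hDε : (1 : ℝ) ≤ D / ε := by rw [le_div_iff₀ hε]; linarith
  have hDπε : (1 : ℝ) ≤ D * π / ε := by rw [le_div_iff₀ hε]; nlinarith
  set z : ℝ := 2 * D * π / ε with hz
  have hz' : z = 2 * (D * π / ε) := by rw [hz]; ring
  have hz2 : 2 ≤ z := by rw [hz']; linarith
  -- Only this lower bound on the logarithm is needed; it turns the factor 24 into 48.
  have hlog : 1 / 2 ≤ Real.log (2 * π / ε) := by
    have h1 : (2 : ℝ) ≤ 2 * π / ε := by rw [le_div_iff₀ hε]; nlinarith
    have h2 := Real.log_le_log (by norm_num) h1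
    have h3 := Real.log_two_gt_d9
    linarith
  have hbound : ∀ (m e : ℕ), (m : ℝ) ≤ 24 * n * z ^ e → e ≤ 48 * Δ * ω →
      (m : ℝ) ≤ (48 : ℕ) * z ^ (48 * Δ * ω) * n * Real.log (2 * π / ε) := by
    intro m e hm he
    have h1 : z ^ e ≤ z ^ (48 * Δ * ω) := pow_le_pow_right₀ (by linarith) he
    calc (m : ℝ) ≤ 24 * n * z ^ (48 * Δ * ω) := hm.trans (by gcongr)
      _ = (48 : ℕ) * z ^ (48 * Δ * ω) * n * (1 / 2) := by push_cast; ring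
      _ ≤ _ := by gcongr
  -- Here the exponent in the bound is 0, so no power of 1/ε is available; but there are no
  -- constraints, or no edges and hence only zero constraints.
  by_cases htriv : Δ = 0 ∨ ω = 0
  · have hbox : ∀ x, P.InBox x → P.ScaledFeasible ε x := by
      refine fun x hx => ⟨hx, fun u k => ?_⟩
      rcases htriv with h | h
      · have h1 := k.2
        have h2 := hΔ u
        omega
      · subst h
        have : P.lhs u k = 0 := by
          classical
          refine Finset.sum_eq_zero fun v hv => ?_
          exact absurd (Finset.mem_filter.1 hv).2 (hω.not_adj u v)
        rw [this]
        simp [polyL1Norm]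
    obtain ⟨s, r, A, b, M, hsr, hA, hb, hM, hsolve⟩ := P.exists_linProg_of_inBox hε.le hbox
    refine ⟨s, r, A, b, M, 1, hbound _ 0 ?_ (Nat.zero_le _), hA, hb, le_rfl, ?_, hM, hsolve⟩
    · have : ((s + r : ℕ) : ℝ) ≤ 16 * n := by exact_mod_cast hsr
      rw [pow_zero]
      linarith
    · push_cast
      linarith
  · push Not at htriv
    obtain ⟨hΔ0, hω0⟩ := htriv
    have hΔ1 : 1 ≤ Δ := Nat.one_le_iff_ne_zero.2 hΔ0
    have hω1 : 1 ≤ ω := Nat.one_le_iff_ne_zero.2 hω0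
    -- Chosen so that εH ≥ 2D ≥ 1 + D: the slack 1 and the D ceilings together stay within the
    -- tolerance.
    set H : ℕ := ⌈2 * D / ε⌉₊ with hH
    have hH1 : 2 * D / ε ≤ H := Nat.le_ceil _
    have hH2 : (H : ℝ) ≤ 3 * (D / ε) := by
      have h1 := (Nat.ceil_lt_add_one (by positivity : 0 ≤ 2 * D / ε)).le
      have h2 : 2 * D / ε = 2 * (D / ε) := by ring
      linarith
    have hεH : 2 * D ≤ ε * H := by
      rw [div_le_iff₀ hε] at hH1
      linarith
    have hDH : D ≤ H := by
      have : (D : ℝ) ≤ H := by nlinarith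
      exact_mod_cast this
    have hHN : H ≤ H * π := Nat.le_mul_of_pos_right _ hπ
    have hN3 : ((H * π : ℕ) : ℝ) ≤ 3 * (D * π / ε) := by
      push_cast
      calc (H : ℝ) * π ≤ 3 * (D / ε) * π := by gcongr
        _ = _ := by ring
    have hN1 : 1 ≤ H * π := (hD.trans hDH).trans hHN
    obtain ⟨s, r, A, b, M, hsr, hA, hb, hM, hsolve⟩ :=
      P.exists_linProg_of_treeWidthLE hω hdeg hp hΔ hΔ1 hN1 hHN hDH rfl hε (by linarith)
    refine ⟨s, r, A, b, M, H * π, hbound _ (4 * (6 * ((ω + 1) * Δ))) ?_ ?_, hA, hb, hN1, ?_, hM,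
      hsolve⟩
    -- The constant 8 is absorbed into z³, as z ≥ 2.
    · have h1 : ((4 * (H * π) + 1 : ℕ) : ℝ) ≤ z ^ 4 := by
        have h2 : (1 : ℝ) ≤ ((H * π : ℕ) : ℝ) := by exact_mod_cast hN1
        have h3 : (8 : ℝ) ≤ z ^ 3 := by
          calc (8 : ℝ) = 2 ^ 3 := by norm_num
            _ ≤ z ^ 3 := by gcongr
        calc ((4 * (H * π) + 1 : ℕ) : ℝ) ≤ 8 * z := by push_cast at h2 hN3 ⊢; linarith
          _ ≤ z ^ 3 * z := by gcongr
          _ = z ^ 4 := by ring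
      calc ((s + r : ℕ) : ℝ)
          ≤ ((8 * (2 * n + 1) * (4 * (H * π) + 1) ^ (6 * ((ω + 1) * Δ)) : ℕ) : ℝ) := by
            exact_mod_cast hsr
        _ = 8 * (2 * n + 1) * ((4 * (H * π) + 1 : ℕ) : ℝ) ^ (6 * ((ω + 1) * Δ)) := by
            push_cast; ring
        _ ≤ 8 * (3 * n) * (z ^ 4) ^ (6 * ((ω + 1) * Δ)) := by
            gcongr
            linarith
        _ = 24 * n * z ^ (4 * (6 * ((ω + 1) * Δ))) := by rw [← pow_mul]; ring
    -- The case ω = 0 being excluded, ω + 1 ≤ 2ω.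
    · calc 4 * (6 * ((ω + 1) * Δ)) ≤ 4 * (6 * ((ω + ω) * Δ)) := by gcongr
        _ = 48 * Δ * ω := by ring
    · push_cast at hN3 ⊢
      linarith
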